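/- Let $K:(0,\infty)\to\mathbb R$ be positive and non-increasing, with $x\mapsto K(|x|)$ locally integrable on $\mathbb R^2$. For a bounded open set $\Omega\subset\mathbb R^2$ let $\mathcal K_\Omega:L^2(\Omega)\to L^2(\Omega)$ be the integral operator $$\mathcal K_\Omega f(x)=\int_\Omega K(|x-y|)f(y)\,dy .$$ A characteristic number of $\mathcal K_\Omega$ is a scalar $\mu$ for which $u=\mu\,\mathcal K_\Omega u$ has a solution $u\neq 0$ in $L^2(\Omega)$ (the inverse of a nonzero eigenvalue), and a first characteristic number is one of smallest modulus. Let $\Delta\subset\mathbb R^2$ be an (open, nondegenerate) equilateral triangle and $\Omega\subset\mathbb R^2$ any (open, nondegenerate) triangle with the same area, $|\Omega|=|\Delta|$, and assume that $\mathcal K_\Delta$ and $\mathcal K_\Omega$ are compact. Then each of $\mathcal K_\Delta$ and $\mathcal K_\Omega$ has exactly one first characteristic number, denoted $\mu_1(\Delta)$ and $\mu_1(\Omega)$ respectively; both are real, and $$0<\mu_1(\Delta)\le\mu_1(\Omega).$$ Moreover $\|\mathcal K_\Delta\|=1/\mu_1(\Delta)$ and $\|\mathcal K_\Omega\|=1/\mu_1(\Omega)$,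 so that equivalently $\|\mathcal K_\Omega\|\le\|\mathcal K_\Delta\|$: among all triangles of a given area, the operator norm is largest on the equilateral triangle. -/

import Mathlib

open MeasureTheory Set
open scoped ENNReal NNReal

/-- The Euclidean plane `ℝ²` (Euclidean norm, Lebesgue measure). -/
abbrev Plane : Type := EuclideanSpace ℝ (Fin 2)

/-- `K(|x|)` is a positive, non-increasing, locally integrable radial kernel on the plane.
The value of `K` at `0` is irrelevant (the diagonal is a null set), so it is not constrained:
both kernels that are finite at `0` and kernels that blow up at `0` are covered. -/
structure IsRadialKernel (K : ℝ → ℝ) : Prop where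
  pos : ∀ ρ : ℝ, 0 < ρ → 0 < K ρ
  anti : ∀ ρ₁ ρ₂ : ℝ, 0 < ρ₁ → ρ₁ ≤ ρ₂ → K ρ₂ ≤ K ρ₁
  locallyIntegrable : LocallyIntegrable (fun x : Plane => K ‖x‖) volume

/-- The space `L²(Ω)` with values in `𝕜`, for the Lebesgue measure. -/
abbrev L2 (𝕜 : Type*) [RCLike 𝕜] (Ω : Set Plane) : Type _ :=
  Lp 𝕜 2 ((volume : Measure Plane).restrict Ω)

section Construction

variable {𝕜 : Type*} [RCLike 𝕜] {K : ℝ → ℝ} {Ω : Set Plane}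

/-- The function `x ↦ ∫_Ω K(|x - y|) f(y) dy`. -/
noncomputable def kernelIntegral (K : ℝ → ℝ) (Ω : Set Plane) (f : Plane → 𝕜) (x : Plane) : 𝕜 :=
  ∫ y in Ω, K ‖x - y‖ • f y

/-- An upper bound for `∫_Ω |K(|x - y|)| dy`, uniform in `x ∈ Ω`. -/
noncomputable def schurBound (K : ℝ → ℝ) (Ω : Set Plane) : ℝ≥0∞ :=
  ∫⁻ z in Metric.closedBall (0 : Plane) (Metric.diam Ω), ‖K ‖z‖‖ₑ

lemma IsRadialKernel.schurBound_ne_top (hK : IsRadialKernel K) (Ω : Set Plane) :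
    schurBound K Ω ≠ ∞ :=
  (hK.locallyIntegrable.integrableOn_isCompact
    (isCompact_closedBall (0 : Plane) (Metric.diam Ω))).2.ne

lemma IsRadialKernel.aestronglyMeasurable (hK : IsRadialKernel K) (Ω : Set Plane) :
    AEStronglyMeasurable (fun p : Plane × Plane => K ‖p.1 - p.2‖)
      ((volume.restrict Ω).prod (volume.restrict Ω)) := by
  have h := hK.locallyIntegrable.aestronglyMeasurable.comp_quasiMeasurePreserving
    (quasiMeasurePreserving_sub (volume : Measure Plane) (volume : Measure Plane))
  rw [Measure.prod_restrict]
  exact h.mono_measure Measure.restrict_le_self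

lemma lintegral_kernel_le (K : ℝ → ℝ) (hb : Bornology.IsBounded Ω)
    (hm : MeasurableSet Ω) {x : Plane} (hx : x ∈ Ω) :
    ∫⁻ y in Ω, ‖K ‖x - y‖‖ₑ ≤ schurBound K Ω := by
  rw [schurBound, ← lintegral_indicator hm,
    ← lintegral_indicator Metric.isClosed_closedBall.measurableSet,
    ← lintegral_sub_left_eq_self ((Metric.closedBall (0 : Plane) (Metric.diam Ω)).indicator _) x]
  refine lintegral_mono fun y => ?_
  by_cases hy : y ∈ Ω
  · have : x - y ∈ Metric.closedBall (0 : Plane) (Metric.diam Ω) := by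
      rw [mem_closedBall_zero_iff, ← dist_eq_norm]
      exact Metric.dist_le_diam_of_mem hb hx hy
    simp [indicator_of_mem hy, indicator_of_mem this]
  · simp [indicator_of_notMem hy]

lemma lintegral_kernel_mul_sq_le (hK : IsRadialKernel K) (ho : IsOpen Ω)
    (hb : Bornology.IsBounded Ω) {f : Plane → 𝕜}
    (hf : AEStronglyMeasurable f (volume.restrict Ω)) :
    ∫⁻ x in Ω, (∫⁻ y in Ω, ‖K ‖x - y‖‖ₑ * ‖f y‖ₑ) ^ 2
      ≤ schurBound K Ω ^ 2 * ∫⁻ y in Ω, ‖f y‖ₑ ^ 2 := by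
  have hm := ho.measurableSet
  have hk : AEMeasurable (fun p : Plane × Plane => ‖K ‖p.1 - p.2‖‖ₑ)
      ((volume.restrict Ω).prod (volume.restrict Ω)) := (hK.aestronglyMeasurable Ω).enorm
  have hkx : ∀ᵐ x ∂(volume.restrict Ω),
      AEMeasurable (fun y => ‖K ‖x - y‖‖ₑ) (volume.restrict Ω) := by
    filter_upwards [(hK.aestronglyMeasurable Ω).prodMk_left] with x hx using hx.enorm
  have hpt : ∀ᵐ x ∂(volume.restrict Ω), (∫⁻ y in Ω, ‖K ‖x - y‖‖ₑ * ‖f y‖ₑ) ^ 2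
      ≤ schurBound K Ω * ∫⁻ y in Ω, ‖K ‖x - y‖‖ₑ * ‖f y‖ₑ ^ 2 := by
    filter_upwards [hkx, ae_restrict_mem hm] with x hx hxΩ
    have h := ENNReal.lintegral_mul_norm_pow_le (p := 1 / 2) (q := 1 / 2) hx
      (hx.mul (hf.enorm.pow_const 2)) (by norm_num) (by norm_num) (by norm_num)
    have e : ∀ y, ‖K ‖x - y‖‖ₑ ^ (1 / 2 : ℝ) *
        (‖K ‖x - y‖‖ₑ * ‖f y‖ₑ ^ 2) ^ (1 / 2 : ℝ) = ‖K ‖x - y‖‖ₑ * ‖f y‖ₑ := by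
      intro y
      rw [ENNReal.mul_rpow_of_nonneg _ _ (by norm_num), ← mul_assoc,
        ← ENNReal.rpow_add_of_nonneg _ _ (by norm_num) (by norm_num), ← ENNReal.rpow_natCast,
        ← ENNReal.rpow_mul]
      norm_num
    have h' : ∫⁻ y in Ω, ‖K ‖x - y‖‖ₑ * ‖f y‖ₑ ≤
        (∫⁻ y in Ω, ‖K ‖x - y‖‖ₑ) ^ (1 / 2 : ℝ) *
          (∫⁻ y in Ω, ‖K ‖x - y‖‖ₑ * ‖f y‖ₑ ^ 2) ^ (1 / 2 : ℝ) := by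
      rw [← lintegral_congr e]
      exact h
    have sq : ∀ a : ℝ≥0∞, (a ^ (1 / 2 : ℝ)) ^ 2 = a := by
      intro a
      rw [← ENNReal.rpow_natCast, ← ENNReal.rpow_mul]
      norm_num
    calc (∫⁻ y in Ω, ‖K ‖x - y‖‖ₑ * ‖f y‖ₑ) ^ 2 ≤ _ := pow_le_pow_left' h' 2
      _ = (∫⁻ y in Ω, ‖K ‖x - y‖‖ₑ) * ∫⁻ y in Ω, ‖K ‖x - y‖‖ₑ * ‖f y‖ₑ ^ 2 := by
        rw [mul_pow, sq, sq]
      _ ≤ _ := by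
        gcongr
        exact lintegral_kernel_le K hb hm hxΩ
  calc _ ≤ ∫⁻ x in Ω, schurBound K Ω * ∫⁻ y in Ω, ‖K ‖x - y‖‖ₑ * ‖f y‖ₑ ^ 2 :=
        lintegral_mono_ae hpt
    _ = schurBound K Ω * ∫⁻ x in Ω, ∫⁻ y in Ω, ‖K ‖x - y‖‖ₑ * ‖f y‖ₑ ^ 2 :=
        lintegral_const_mul' _ _ (hK.schurBound_ne_top Ω)
    _ = schurBound K Ω * ∫⁻ y in Ω, (∫⁻ x in Ω, ‖K ‖x - y‖‖ₑ) * ‖f y‖ₑ ^ 2 := by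
        rw [lintegral_lintegral_swap (hk.mul (hf.enorm.pow_const 2).comp_snd)]
        congr 1
        refine lintegral_congr fun y => lintegral_mul_const' _ _ ?_
        exact ENNReal.pow_ne_top enorm_ne_top
    _ ≤ schurBound K Ω * ∫⁻ y in Ω, schurBound K Ω * ‖f y‖ₑ ^ 2 := by
        gcongr 1
        refine lintegral_mono_ae ?_
        filter_upwards [ae_restrict_mem hm] with y hy
        gcongr
        simp_rw [norm_sub_rev _ y]
        exact lintegral_kernel_le K hb hm hy
    _ = _ := by
        rw [lintegral_const_mul' _ _ (hK.schurBound_ne_top Ω), ← mul_assoc, sq]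

lemma eLpNorm_two_sq (f : Plane → 𝕜) :
    eLpNorm f 2 (volume.restrict Ω) ^ 2 = ∫⁻ y in Ω, ‖f y‖ₑ ^ 2 := by
  have h := eLpNorm_nnreal_pow_eq_lintegral (f := f) (μ := volume.restrict Ω)
    (p := 2) (by norm_num)
  have e : ((2 : ℝ≥0) : ℝ) = ((2 : ℕ) : ℝ) := by norm_num
  simp only [e, ENNReal.rpow_natCast] at h
  exact h

/-- For `f ∈ L²(Ω)` and almost every `x ∈ Ω` the integral defining `K_Ω f (x)` converges
absolutely. -/
lemma ae_integrable_kernel (hK : IsRadialKernel K) (ho : IsOpen Ω)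
    (hb : Bornology.IsBounded Ω) {f : Plane → 𝕜} (hf : MemLp f 2 (volume.restrict Ω)) :
    ∀ᵐ x ∂(volume.restrict Ω),
      Integrable (fun y => K ‖x - y‖ • f y) (volume.restrict Ω) := by
  have hk : AEMeasurable (fun p : Plane × Plane => ‖K ‖p.1 - p.2‖‖ₑ * ‖f p.2‖ₑ)
      ((volume.restrict Ω).prod (volume.restrict Ω)) :=
    (hK.aestronglyMeasurable Ω).enorm.mul hf.1.enorm.comp_snd
  have h := lintegral_kernel_mul_sq_le hK ho hb hf.1
  rw [← eLpNorm_two_sq] at h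
  have hfin : ∫⁻ x in Ω, (∫⁻ y in Ω, ‖K ‖x - y‖‖ₑ * ‖f y‖ₑ) ^ 2 ≠ ∞ :=
    (h.trans_lt (ENNReal.mul_lt_top (ENNReal.pow_lt_top (hK.schurBound_ne_top Ω).lt_top)
      (ENNReal.pow_lt_top hf.2))).ne
  filter_upwards [ae_lt_top' (hk.lintegral_prod_right'.pow_const 2) hfin,
    (hK.aestronglyMeasurable Ω).prodMk_left] with x hx hmx
  refine ⟨hmx.smul hf.1, ?_⟩
  have := (ENNReal.pow_lt_top_iff (n := 2)).1 hx
  simpa [HasFiniteIntegral, enorm_smul] using this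

lemma aestronglyMeasurable_kernelIntegral (hK : IsRadialKernel K) {f : Plane → 𝕜}
    (hf : AEStronglyMeasurable f (volume.restrict Ω)) :
    AEStronglyMeasurable (kernelIntegral K Ω f) (volume.restrict Ω) :=
  ((hK.aestronglyMeasurable Ω).smul hf.comp_snd).integral_prod_right'

lemma eLpNorm_kernelIntegral_le (hK : IsRadialKernel K) (ho : IsOpen Ω)
    (hb : Bornology.IsBounded Ω) {f : Plane → 𝕜}
    (hf : AEStronglyMeasurable f (volume.restrict Ω)) :
    eLpNorm (kernelIntegral K Ω f) 2 (volume.restrict Ω)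
      ≤ schurBound K Ω * eLpNorm f 2 (volume.restrict Ω) := by
  refine (ENNReal.pow_le_pow_left_iff two_ne_zero).1 ?_
  rw [mul_pow, eLpNorm_two_sq, eLpNorm_two_sq]
  refine le_trans (lintegral_mono fun x => ?_) (lintegral_kernel_mul_sq_le hK ho hb hf)
  refine pow_le_pow_left' ((enorm_integral_le_lintegral_enorm _).trans_eq ?_) 2
  simp [enorm_smul]

lemma memLp_kernelIntegral (hK : IsRadialKernel K) (ho : IsOpen Ω)
    (hb : Bornology.IsBounded Ω) {f : Plane → 𝕜} (hf : MemLp f 2 (volume.restrict Ω)) :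
    MemLp (kernelIntegral K Ω f) 2 (volume.restrict Ω) :=
  ⟨aestronglyMeasurable_kernelIntegral hK hf.1,
    (eLpNorm_kernelIntegral_le hK ho hb hf.1).trans_lt
      (ENNReal.mul_lt_top (hK.schurBound_ne_top Ω).lt_top hf.2)⟩

end Construction

/-- The integral operator `K_Ω : L²(Ω) → L²(Ω)`, `K_Ω f (x) = ∫_Ω K(|x - y|) f(y) dy`, for a
bounded open set `Ω` of the plane. -/
noncomputable def kernelOp (𝕜 : Type*) [RCLike 𝕜] {K : ℝ → ℝ} (hK : IsRadialKernel K)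
    {Ω : Set Plane} (ho : IsOpen Ω) (hb : Bornology.IsBounded Ω) : L2 𝕜 Ω →L[𝕜] L2 𝕜 Ω :=
  LinearMap.mkContinuous
    { toFun := fun f => (memLp_kernelIntegral hK ho hb (Lp.memLp f)).toLp _
      map_add' := by
        intro f g
        rw [← MemLp.toLp_add]
        refine MemLp.toLp_congr _ _ ?_
        filter_upwards [ae_integrable_kernel hK ho hb (Lp.memLp f),
          ae_integrable_kernel hK ho hb (Lp.memLp g)] with x hf hg
        simp only [kernelIntegral, Pi.add_apply]
        rw [← integral_add hf hg]
        refine integral_congr_ae ?_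
        filter_upwards [Lp.coeFn_add f g] with y hy
        rw [hy, Pi.add_apply, smul_add]
      map_smul' := by
        intro c f
        rw [RingHom.id_apply, ← MemLp.toLp_const_smul]
        refine MemLp.toLp_congr _ _ (Filter.Eventually.of_forall fun x => ?_)
        simp only [kernelIntegral, Pi.smul_apply]
        rw [← integral_smul]
        refine integral_congr_ae ?_
        filter_upwards [Lp.coeFn_smul c f] with y hy
        rw [hy, Pi.smul_apply, smul_comm] }
    (schurBound K Ω).toReal (by
      intro f
      have h := eLpNorm_kernelIntegral_le hK ho hb (Lp.memLp f).1
      simp only [LinearMap.coe_mk, AddHom.coe_mk, Lp.norm_toLp]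
      rw [Lp.norm_def, ← ENNReal.toReal_mul]
      exact ENNReal.toReal_mono
        (ENNReal.mul_lt_top (hK.schurBound_ne_top Ω).lt_top (Lp.memLp f).2).ne h)

lemma kernelOp_ae_eq (𝕜 : Type*) [RCLike 𝕜] {K : ℝ → ℝ} (hK : IsRadialKernel K)
    {Ω : Set Plane} (ho : IsOpen Ω) (hb : Bornology.IsBounded Ω) (f : L2 𝕜 Ω) :
    ∀ᵐ x ∂(volume.restrict Ω), kernelOp 𝕜 hK ho hb f x = ∫ y in Ω, K ‖x - y‖ • f y :=
  (memLp_kernelIntegral hK ho hb (Lp.memLp f)).coeFn_toLp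

/-- `μ` is a characteristic number of `T`: there is `u ≠ 0` with `u = μ T u`, that is, `μ` is the
inverse of a nonzero eigenvalue of `T`. -/
def IsCharacteristicNumber {𝕜 H : Type*} [RCLike 𝕜] [NormedAddCommGroup H] [NormedSpace 𝕜 H]
    (T : H →L[𝕜] H) (μ : 𝕜) : Prop :=
  ∃ u : H, u ≠ 0 ∧ u = μ • T u

/-- `μ` is a first characteristic number of `T`: one of smallest modulus. -/
def IsFirstCharacteristicNumber {𝕜 H : Type*} [RCLike 𝕜] [NormedAddCommGroup H]
    [NormedSpace 𝕜 H] (T : H →L[𝕜] H) (μ : 𝕜) : Prop :=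
  IsCharacteristicNumber T μ ∧ ∀ ν : 𝕜, IsCharacteristicNumber T ν → ‖μ‖ ≤ ‖ν‖

/-- The open domain bounded by a (nondegenerate) triangle. -/
def triangleDomain (t : Affine.Triangle ℝ Plane) : Set Plane :=
  interior (convexHull ℝ (range t.points))

lemma isOpen_triangleDomain (t : Affine.Triangle ℝ Plane) : IsOpen (triangleDomain t) :=
  isOpen_interior

lemma isBounded_triangleDomain (t : Affine.Triangle ℝ Plane) :
    Bornology.IsBounded (triangleDomain t) :=
  (isBounded_convexHull.2 (finite_range t.points).isBounded).subset interior_subset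

/-- The operator `K_Ω` for `Ω` a triangle. -/
noncomputable def triangleOp (𝕜 : Type*) [RCLike 𝕜] {K : ℝ → ℝ} (hK : IsRadialKernel K)
    (t : Affine.Triangle ℝ Plane) :
    L2 𝕜 (triangleDomain t) →L[𝕜] L2 𝕜 (triangleDomain t) :=
  kernelOp 𝕜 hK (isOpen_triangleDomain t) (isBounded_triangleDomain t)

/-! Since the kernel is positive, a Perron–Frobenius argument applies to the compact self-adjoint
operator `T`: the number `‖T‖` is an eigenvalue with a nonnegative eigenvector, which is not
orthogonal to the constant `1`, while `-‖T‖` is not an eigenvalue. So `1/‖T‖` is the only first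
characteristic number (`isFirstCharacteristicNumber_kernelOp_iff`), and `‖T‖` governs the growth of
`⟪1, Tⁿ 1⟫`, the integral of `K(|x₀-x₁|)⋯K(|xₙ₋₁-xₙ|)` over all chains of points. It suffices to
compare these chain integrals for every `n` (`norm_kernelOp_le_of_chainTotal_le`).

Affine coordinates carry every triangle to one standard triangle; the shape survives only in the
form `E(α+sβ)² + Hβ²`, where `EH` is fixed by the area. Steiner symmetrization about the
perpendicular bisector of the base sets `s = 1/2` and does not decrease the chain integrals
(`chainTotal_le_symmetrized`); it is proved slice by slice, by induction on `n`. Taking a leg of the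
isosceles triangle as the new base and symmetrizing again sends `E` to `E/4 + D/E`, with `D = EH`.
The iterates converge to the fixed point `E² = 4D/3`, the equilateral triangle. The limit is reached
by comparison with a dilated triangle, at the cost of a factor tending to `1`
(`chainTotal_le_of_form_le`). -/

/-! ### Chain integrals and change of variables -/

section Chain

variable {X Y : Type*} [MeasurableSpace X] [MeasurableSpace Y]

/-- The iterates `Sⁿ 1` of the integral operator with kernel `κ` with respect to `μ`. -/
noncomputable def chainIter (κ : X → X → ℝ≥0∞) (μ : Measure X) : ℕ → X → ℝ≥0∞
  | 0 => fun _ => 1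
  | n + 1 => fun x => ∫⁻ y, κ x y * chainIter κ μ n y ∂μ

/-- The chain integral `∫ Sⁿ 1 dμ`. -/
noncomputable def chainTotal (κ : X → X → ℝ≥0∞) (μ : Measure X) (n : ℕ) : ℝ≥0∞ :=
  ∫⁻ x, chainIter κ μ n x ∂μ

lemma measurable_chainIter {κ : X → X → ℝ≥0∞} (hκ : Measurable (Function.uncurry κ))
    (μ : Measure X) [SFinite μ] (n : ℕ) : Measurable (chainIter κ μ n) := by
  induction n with
  | zero => exact measurable_const
  | succ n ih => exact (hκ.mul (ih.comp measurable_snd)).lintegral_prod_right'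

/-- Substituting `φ` in each of the `n` integrations can only enlarge the kernel, and moving the
measure costs `c` each time. Affine parametrizations, the exchange of coordinates and dilations are
all handled this way. -/
lemma chainIter_le {κ : X → X → ℝ≥0∞} {κ' : Y → Y → ℝ≥0∞} {μ : Measure X} {ν : Measure Y}
    [SFinite ν] (hκ' : Measurable (Function.uncurry κ')) {φ : X → Y} (hφ : Measurable φ)
    (hle : ∀ x y, κ x y ≤ κ' (φ x) (φ y)) {c : ℝ≥0∞} (hμ : μ.map φ ≤ c • ν) (n : ℕ) (x : X) :
    chainIter κ μ n x ≤ c ^ n * chainIter κ' ν n (φ x) := by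
  induction n generalizing x with
  | zero => simp [chainIter]
  | succ n ih =>
    have hm : Measurable fun z => κ' (φ x) z * (c ^ n * chainIter κ' ν n z) :=
      (hκ'.comp measurable_prodMk_left).mul ((measurable_chainIter hκ' ν n).const_mul _)
    calc ∫⁻ y, κ x y * chainIter κ μ n y ∂μ
        ≤ ∫⁻ y, κ' (φ x) (φ y) * (c ^ n * chainIter κ' ν n (φ y)) ∂μ := by
          gcongr with y
          exacts [hle x y, ih y]
      _ = ∫⁻ z, κ' (φ x) z * (c ^ n * chainIter κ' ν n z) ∂(μ.map φ) :=
          (lintegral_map hm hφ).symm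
      _ ≤ ∫⁻ z, κ' (φ x) z * (c ^ n * chainIter κ' ν n z) ∂(c • ν) := lintegral_mono' hμ le_rfl
      _ = c * ∫⁻ z, c ^ n * (κ' (φ x) z * chainIter κ' ν n z) ∂ν := by
          rw [lintegral_smul_measure, smul_eq_mul]
          congr 2 with z
          ring
      _ = c ^ (n + 1) * chainIter κ' ν (n + 1) (φ x) := by
          have hm' : Measurable fun z => κ' (φ x) z * chainIter κ' ν n z :=
            (hκ'.comp measurable_prodMk_left).mul (measurable_chainIter hκ' ν n)
          rw [lintegral_const_mul _ hm', pow_succ']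
          simp only [chainIter]
          ring

lemma chainTotal_le {κ : X → X → ℝ≥0∞} {κ' : Y → Y → ℝ≥0∞} {μ : Measure X} {ν : Measure Y}
    [SFinite ν] (hκ' : Measurable (Function.uncurry κ')) {φ : X → Y} (hφ : Measurable φ)
    (hle : ∀ x y, κ x y ≤ κ' (φ x) (φ y)) {c : ℝ≥0∞} (hμ : μ.map φ ≤ c • ν) (n : ℕ) :
    chainTotal κ μ n ≤ c ^ (n + 1) * chainTotal κ' ν n := by
  have hm : Measurable fun z => c ^ n * chainIter κ' ν n z :=
    (measurable_chainIter hκ' ν n).const_mul _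
  calc ∫⁻ x, chainIter κ μ n x ∂μ
      ≤ ∫⁻ x, c ^ n * chainIter κ' ν n (φ x) ∂μ :=
        lintegral_mono fun x => chainIter_le hκ' hφ hle hμ n x
    _ = ∫⁻ z, c ^ n * chainIter κ' ν n z ∂(μ.map φ) := (lintegral_map hm hφ).symm
    _ ≤ ∫⁻ z, c ^ n * chainIter κ' ν n z ∂(c • ν) := lintegral_mono' hμ le_rfl
    _ = c ^ (n + 1) * chainTotal κ' ν n := by
        rw [lintegral_smul_measure, smul_eq_mul, lintegral_const_mul _
          (measurable_chainIter hκ' ν n), chainTotal]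
        ring

end Chain

/-! ### One-dimensional rearrangement -/

section Rearrangement

open Metric

/-- Layer-cake representation of an extended nonnegative number. -/
lemma lintegral_indicator_ofReal_lt (a : ℝ≥0∞) :
    ∫⁻ t in Ioi (0 : ℝ), {t : ℝ | ENNReal.ofReal t < a}.indicator 1 t = a := by
  have hm : MeasurableSet {t : ℝ | ENNReal.ofReal t < a} :=
    measurableSet_lt ENNReal.measurable_ofReal measurable_const
  rw [lintegral_indicator_one hm, Measure.restrict_apply hm]
  rcases eq_or_ne a ∞ with rfl | ha
  · simp
  · have : {t : ℝ | ENNReal.ofReal t < a} ∩ Ioi 0 = Ioo 0 a.toReal := by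
      ext t
      simp only [mem_inter_iff, mem_ofPred_eq, mem_Ioi, mem_Ioo]
      constructor
      · rintro ⟨h, h0⟩
        exact ⟨h0, (ENNReal.ofReal_lt_iff_lt_toReal h0.le ha).1 h⟩
      · rintro ⟨h0, h⟩
        exact ⟨(ENNReal.ofReal_lt_iff_lt_toReal h0.le ha).2 h, h0⟩
    rw [this, Real.volume_Ioo, sub_zero, ENNReal.ofReal_toReal ha]

/-- The integral over an interval of fixed length of a symmetric decreasing function decreases
with the distance of the centre from the origin. -/
lemma setLIntegral_ball_le_of_abs_le {k : ℝ → ℝ≥0∞} (hk : ∀ x y, |x| ≤ |y| → k y ≤ k x)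
    {x x' : ℝ} (h : |x| ≤ |x'|) (r : ℝ) :
    ∫⁻ y in ball x' r, k y ≤ ∫⁻ y in ball x r, k y := by
  rw [← lintegral_inter_add_sdiff k (ball x' r) measurableSet_ball,
    ← lintegral_inter_add_sdiff k (ball x r) (measurableSet_ball (x := x') (ε := r)),
    inter_comm (ball x r)]
  gcongr 1
  -- The common part of the intervals cancels; the reflection `y ↦ x + x' - y` exchanges the two
  -- remainders.
  rw [← lintegral_indicator (measurableSet_ball.diff measurableSet_ball),
    ← lintegral_indicator (measurableSet_ball.diff measurableSet_ball),
    ← lintegral_sub_left_eq_self ((ball x r \ ball x' r).indicator k) (x + x')]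
  refine lintegral_mono fun y => ?_
  by_cases hy : y ∈ ball x' r \ ball x r
  · have hy' : x + x' - y ∈ ball x r \ ball x' r := by
      simp only [mem_sdiff, mem_ball, Real.dist_eq] at hy ⊢
      rw [show x + x' - y - x = -(y - x') by ring, show x + x' - y - x' = -(y - x) by ring,
        abs_neg, abs_neg]
      exact hy
    rw [indicator_of_mem hy, indicator_of_mem hy']
    apply hk
    have h1 : |y - x'| < |y - x| := by
      simp only [mem_sdiff, mem_ball, Real.dist_eq, not_lt] at hy
      exact hy.1.trans_le hy.2
    have h2 := sq_lt_sq.2 h1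
    have h3 := sq_le_sq.2 h
    apply sq_le_sq.1
    -- Dividing by `(x' - x)²` leaves `(x + x')(2y - (x + x'))`, which equals `y² - (x + x' - y)²`:
    -- the reflected point is no farther from the origin.
    have h4 : 0 ≤ (x' ^ 2 - x ^ 2) * ((y - x) ^ 2 - (y - x') ^ 2) :=
      mul_nonneg (by linarith) (by linarith)
    have h5 : (x' ^ 2 - x ^ 2) * ((y - x) ^ 2 - (y - x') ^ 2)
        = (x' - x) ^ 2 * ((x + x') * (2 * y - (x + x'))) := by ring
    rw [h5] at h4
    have h6 : 0 < (x' - x) ^ 2 := by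
      refine (sq_nonneg _).lt_of_ne' fun h0 => ?_
      have : x' = x := by nlinarith
      subst this
      exact lt_irrefl _ h2
    have h7 := nonneg_of_mul_nonneg_right h4 h6
    nlinarith
  · rw [indicator_of_notMem hy]
    exact zero_le

/-- If the integrals of `g` over intervals are dominated by those of `h` over the intervals of the
same length centred at `m`, then the same holds for the integrals against symmetric decreasing
weights. -/
lemma setLIntegral_mul_le_of_forall_ball {g h : ℝ → ℝ≥0∞} (hg : Measurable g) (hh : Measurable h)
    {m : ℝ} (hgh : ∀ c r, ∫⁻ x in ball c r, g x ≤ ∫⁻ x in ball m r, h x)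
    {ψ : ℝ → ℝ≥0∞} (hψm : Measurable ψ) (hψ : ∀ x y, |x| ≤ |y| → ψ y ≤ ψ x) (c₀ M c : ℝ) :
    ∫⁻ x in ball c₀ M, ψ (x - c) * g x ≤ ∫⁻ x in ball m M, ψ (x - m) * h x := by
  -- Layer cake in `ψ` and Tonelli reduce the claim to the superlevel sets of `ψ`, which are
  -- symmetric intervals.
  have key : ∀ (f : ℝ → ℝ≥0∞) (_ : Measurable f) (a b : ℝ),
      ∫⁻ x in ball a M, ψ (x - b) * f x
        = ∫⁻ t in Ioi (0 : ℝ), ∫⁻ x in ball a M ∩ {x | ENNReal.ofReal t < ψ (x - b)}, f x := by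
    intro f hf a b
    have hmeas : MeasurableSet {p : ℝ × ℝ | ENNReal.ofReal p.2 < ψ (p.1 - b)} :=
      measurableSet_lt (ENNReal.measurable_ofReal.comp measurable_snd)
        (hψm.comp (measurable_fst.sub_const b))
    calc ∫⁻ x in ball a M, ψ (x - b) * f x
        = ∫⁻ x in ball a M, ∫⁻ t in Ioi (0 : ℝ),
            {p : ℝ × ℝ | ENNReal.ofReal p.2 < ψ (p.1 - b)}.indicator (fun p => f p.1) (x, t) := by
          refine lintegral_congr fun x => ?_
          rw [← lintegral_indicator_ofReal_lt (ψ (x - b)), ← lintegral_mul_const]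
          · refine lintegral_congr fun t => ?_
            by_cases ht : ENNReal.ofReal t < ψ (x - b) <;> simp [indicator, ht]
          · exact measurable_const.indicator
              (measurableSet_lt ENNReal.measurable_ofReal measurable_const)
      _ = ∫⁻ t in Ioi (0 : ℝ), ∫⁻ x in ball a M,
            {p : ℝ × ℝ | ENNReal.ofReal p.2 < ψ (p.1 - b)}.indicator (fun p => f p.1) (x, t) :=
          lintegral_lintegral_swap
            (((hf.comp measurable_fst).indicator hmeas).aemeasurable)
      _ = _ := by
          refine lintegral_congr fun t => ?_
          have hmt : MeasurableSet {x | ENNReal.ofReal t < ψ (x - b)} :=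
            measurableSet_lt measurable_const (hψm.comp (measurable_id.sub_const b))
          rw [inter_comm, ← setLIntegral_indicator hmt]
          rfl
  rw [key g hg, key h hh]
  refine lintegral_mono fun t => ?_
  set U : Set ℝ := {x | ENNReal.ofReal t < ψ x} with hU
  have hUs : ∀ x y, |x| ≤ |y| → y ∈ U → x ∈ U := fun x y hxy hy => lt_of_lt_of_le hy (hψ x y hxy)
  -- If the level set covers the window, the window alone is kept. Otherwise the level set has
  -- half-length `ρ ≤ M`; the window is dropped on the left and is no constraint on the right, being
  -- concentric there.
  by_cases hM : ball 0 M ⊆ U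
  · calc _ ≤ ∫⁻ x in ball c₀ M, g x := lintegral_mono_set inter_subset_left
      _ ≤ ∫⁻ x in ball m M, h x := hgh c₀ M
      _ ≤ _ := by
        refine lintegral_mono_set fun x hx => ⟨hx, ?_⟩
        apply hM
        simpa [Real.dist_eq] using hx
  · obtain ⟨x₀, hx₀, hx₀U⟩ := not_subset.1 hM
    have hub : ∀ y ∈ U, |y| < |x₀| := fun y hy => lt_of_not_ge fun h => hx₀U (hUs _ _ h hy)
    have hbdd : BddAbove (abs '' U) := ⟨|x₀|, by
      rintro _ ⟨y, hy, rfl⟩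
      exact (hub y hy).le⟩
    set ρ := sSup (abs '' U)
    have hρ : ∀ y ∈ U, |y| ≤ ρ := fun y hy => le_csSup hbdd ⟨y, hy, rfl⟩
    have hρU : ∀ y, |y| < ρ → y ∈ U := by
      intro y hy
      -- For empty `U` the convention `sSup ∅ = 0` makes `|y| < ρ` impossible.
      have hne : (abs '' U).Nonempty := by
        by_contra hne
        rw [not_nonempty_iff_eq_empty] at hne
        simp only [ρ, hne, Real.sSup_empty] at hy
        exact absurd hy (not_lt.2 (abs_nonneg y))
      obtain ⟨_, ⟨z, hz, rfl⟩, hyz⟩ := exists_lt_of_lt_csSup hne hy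
      exact hUs y z hyz.le hz
    have hρM : ρ ≤ M := by
      have : |x₀| < M := by simpa using hx₀
      refine Real.sSup_le ?_ ((abs_nonneg x₀).trans this.le)
      rintro _ ⟨y, hy, rfl⟩
      exact ((hub y hy).trans this).le
    calc _ ≤ ∫⁻ x in closedBall c ρ, g x := by
          refine lintegral_mono_set fun x hx => ?_
          have := hρ _ hx.2
          simpa [Real.dist_eq] using this
      _ = ∫⁻ x in ball c ρ, g x := by
          refine setLIntegral_congr ?_
          rw [Real.closedBall_eq_Icc, Real.ball_eq_Ioo]
          exact Ioo_ae_eq_Icc.symm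
      _ ≤ ∫⁻ x in ball m ρ, h x := hgh c ρ
      _ ≤ _ := by
          refine lintegral_mono_set fun x hx => ⟨ball_subset_ball hρM hx, hρU _ ?_⟩
          simpa [Real.dist_eq] using hx

end Rearrangement

/-! ### Symmetrization on the standard triangle -/

section StandardTriangle

open Metric

/-- The open triangle with vertices `(0, 0)`, `(1, 0)`, `(0, 1)`. -/
def stdTriangle : Set (ℝ × ℝ) := {p | 0 < p.1 ∧ 0 < p.2 ∧ p.1 + p.2 < 1}

/-- Lebesgue measure on the standard triangle. -/
noncomputable def stdMeasure : Measure (ℝ × ℝ) := volume.restrict stdTriangle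

instance : SFinite stdMeasure := by unfold stdMeasure; infer_instance

lemma measurableSet_stdTriangle : MeasurableSet stdTriangle :=
  (measurableSet_lt measurable_const measurable_fst).inter
    ((measurableSet_lt measurable_const measurable_snd).inter
      (measurableSet_lt (measurable_fst.add measurable_snd) measurable_const))

/-- The quadratic form `E (α + s β)² + H β²`. -/
def quadForm (E s H : ℝ) (p : ℝ × ℝ) : ℝ := E * (p.1 + s * p.2) ^ 2 + H * p.2 ^ 2

/-- The difference kernel attached to a profile `κ` of a quadratic form. -/
def formKernel (κ : ℝ → ℝ≥0∞) (E s H : ℝ) (p q : ℝ × ℝ) : ℝ≥0∞ := κ (quadForm E s H (p - q))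

variable {κ : ℝ → ℝ≥0∞}

lemma measurable_formKernel (hκ : Antitone κ) (E s H : ℝ) :
    Measurable (Function.uncurry (formKernel κ E s H)) := by
  refine hκ.measurable.comp ?_
  unfold quadForm
  fun_prop

lemma lintegral_stdMeasure {f : ℝ × ℝ → ℝ≥0∞} (hf : Measurable f) :
    ∫⁻ p, f p ∂stdMeasure
      = ∫⁻ b in Ioi (0 : ℝ), ∫⁻ a in ball ((1 - b) / 2) ((1 - b) / 2), f (a, b) := by
  rw [stdMeasure, ← lintegral_indicator measurableSet_stdTriangle, Measure.volume_eq_prod,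
    lintegral_prod_symm' _ (hf.indicator measurableSet_stdTriangle),
    ← lintegral_indicator measurableSet_Ioi]
  refine lintegral_congr fun b => ?_
  by_cases hb : 0 < b
  · rw [indicator_of_mem (mem_Ioi.2 hb), ← lintegral_indicator measurableSet_ball]
    refine lintegral_congr fun a => ?_
    have : (a, b) ∈ stdTriangle ↔ a ∈ ball ((1 - b) / 2) ((1 - b) / 2) := by
      rw [Real.ball_eq_Ioo]
      simp only [stdTriangle, mem_ofPred_eq, mem_Ioo]
      constructor
      · rintro ⟨h1, -, h3⟩
        constructor <;> linarith
      · rintro ⟨h1, h2⟩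
        exact ⟨by linarith, hb, by linarith⟩
    by_cases h : (a, b) ∈ stdTriangle
    · rw [indicator_of_mem h, indicator_of_mem (this.1 h)]
    · rw [indicator_of_notMem h, indicator_of_notMem (fun h' => h (this.2 h'))]
  · rw [indicator_of_notMem (by simpa using hb)]
    refine lintegral_eq_zero_of_ae_eq_zero (Filter.Eventually.of_forall fun a => ?_)
    exact indicator_of_notMem (fun h => hb h.2.1) _

/-- Reflecting and translating the variable moves the shear `s` from the kernel into the centre of
the interval, where only the distance of that centre from the origin matters. -/
lemma setLIntegral_ball_formKernel (κ : ℝ → ℝ≥0∞) (E s H c r b : ℝ) (q : ℝ × ℝ) :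
    ∫⁻ a in ball c r, formKernel κ E s H (a, b) q
      = ∫⁻ y in ball (q.1 - (c + s * (b - q.2))) r,
          κ (E * y ^ 2 + H * (b - q.2) ^ 2) := by
  rw [← lintegral_indicator measurableSet_ball, ← lintegral_indicator measurableSet_ball,
    ← lintegral_sub_left_eq_self ((ball (q.1 - (c + s * (b - q.2))) r).indicator _)
      (q.1 - s * (b - q.2))]
  refine lintegral_congr fun a => ?_
  have : a ∈ ball c r ↔ q.1 - s * (b - q.2) - a ∈ ball (q.1 - (c + s * (b - q.2))) r := by
    simp only [mem_ball, Real.dist_eq]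
    rw [show q.1 - s * (b - q.2) - a - (q.1 - (c + s * (b - q.2))) = -(a - c) by ring, abs_neg]
  by_cases h : a ∈ ball c r
  · rw [indicator_of_mem h, indicator_of_mem (this.1 h)]
    simp only [formKernel, quadForm, Prod.fst_sub, Prod.snd_sub]
    ring_nf
  · rw [indicator_of_notMem h, indicator_of_notMem (fun h' => h (this.2 h'))]

/-- Integrals over horizontal intervals of an iterate of the kernel operator. -/
lemma setLIntegral_ball_chainIter_succ (hκ : Antitone κ) (E s H : ℝ) (n : ℕ) (c r b : ℝ) :
    ∫⁻ a in ball c r, chainIter (formKernel κ E s H) stdMeasure (n + 1) (a, b)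
      = ∫⁻ b' in Ioi (0 : ℝ), ∫⁻ a' in ball ((1 - b') / 2) ((1 - b') / 2),
          (∫⁻ y in ball (a' - (c + s * (b - b'))) r, κ (E * y ^ 2 + H * (b - b') ^ 2))
            * chainIter (formKernel κ E s H) stdMeasure n (a', b') := by
  have hm := measurable_formKernel hκ E s H
  have hi := measurable_chainIter hm stdMeasure n
  have hm' : Measurable fun p : ℝ × (ℝ × ℝ) => formKernel κ E s H (p.1, b) p.2 :=
    hm.comp (f := fun p : ℝ × (ℝ × ℝ) => ((p.1, b), p.2)) (by fun_prop)
  simp only [chainIter]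
  rw [lintegral_lintegral_swap (hm'.mul (hi.comp measurable_snd)).aemeasurable]
  rw [← lintegral_stdMeasure (f := fun q => (∫⁻ y in ball (q.1 - (c + s * (b - q.2))) r,
    κ (E * y ^ 2 + H * (b - q.2) ^ 2)) * chainIter (formKernel κ E s H) stdMeasure n q)]
  · refine lintegral_congr fun q => ?_
    have hq : Measurable fun a => formKernel κ E s H (a, b) q :=
      hm'.comp (measurable_id.prodMk measurable_const)
    rw [lintegral_mul_const _ hq, setLIntegral_ball_formKernel]
  · refine Measurable.mul ?_ hi
    simp_rw [← setLIntegral_ball_formKernel]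
    exact (hm'.comp measurable_swap).lintegral_prod_right'

/-- **Steiner symmetrization** along the base, at the level of iterates: shearing the form so that
the triangle becomes isosceles increases the integrals over intervals. -/
lemma setLIntegral_ball_chainIter_le (hκ : Antitone κ) {E H : ℝ} (hE : 0 ≤ E) (s : ℝ) (n : ℕ)
    (b c r : ℝ) :
    ∫⁻ a in ball c r, chainIter (formKernel κ E s H) stdMeasure n (a, b)
      ≤ ∫⁻ a in ball ((1 - b) / 2) r,
          chainIter (formKernel κ E (1 / 2) H) stdMeasure n (a, b) := by
  -- The hypothesis is needed for all centres and radii: the layer-cake argument cuts slices at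
  -- arbitrary intervals.
  induction n generalizing b c r with
  | zero => simp [chainIter]
  | succ n ih =>
    rw [setLIntegral_ball_chainIter_succ hκ, setLIntegral_ball_chainIter_succ hκ]
    refine lintegral_mono fun b' => ?_
    set k : ℝ → ℝ≥0∞ := fun y => κ (E * y ^ 2 + H * (b - b') ^ 2) with hk
    have hks : ∀ x y, |x| ≤ |y| → k y ≤ k x := fun x y h => by
      have := sq_le_sq.2 h
      exact hκ (by gcongr)
    have hkm : Measurable k := hκ.measurable.comp (by fun_prop)
    have hψ : Measurable fun x => ∫⁻ y in ball x r, k y := by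
      have : ∀ x, ∫⁻ y in ball x r, k y
          = ∫⁻ y, {p : ℝ × ℝ | dist p.2 p.1 < r}.indicator (fun p => k p.2) (x, y) := fun x => by
        rw [← lintegral_indicator measurableSet_ball]
        rfl
      simp_rw [this]
      refine Measurable.lintegral_prod_right' (Measurable.indicator (hkm.comp measurable_snd) ?_)
      exact measurableSet_lt (measurable_snd.dist measurable_fst) measurable_const
    have hi : ∀ s, Measurable fun a => chainIter (formKernel κ E s H) stdMeasure n (a, b') :=
      fun s => (measurable_chainIter (measurable_formKernel hκ E s H) stdMeasure n).comp
        (measurable_id.prodMk measurable_const)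
    have h := setLIntegral_mul_le_of_forall_ball (hi s) (hi (1 / 2)) (fun c r => ih b' c r) hψ
      (fun x y hxy => setLIntegral_ball_le_of_abs_le hks hxy r)
      ((1 - b') / 2) ((1 - b') / 2) (c + s * (b - b'))
    -- For `s = 1/2` the shear carries midpoints of slices to midpoints of slices, so the weight is
    -- centred on the slice at `b'`.
    rwa [show (1 - b) / 2 + 1 / 2 * (b - b') = (1 - b') / 2 by ring]

lemma chainTotal_le_symmetrized (hκ : Antitone κ) {E H : ℝ} (hE : 0 ≤ E) (s : ℝ) (n : ℕ) :
    chainTotal (formKernel κ E s H) stdMeasure n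
      ≤ chainTotal (formKernel κ E (1 / 2) H) stdMeasure n := by
  unfold chainTotal
  rw [lintegral_stdMeasure (measurable_chainIter (measurable_formKernel hκ E s H) _ n),
    lintegral_stdMeasure (measurable_chainIter (measurable_formKernel hκ E (1 / 2) H) _ n)]
  exact lintegral_mono fun b => setLIntegral_ball_chainIter_le hκ hE s n b _ _

lemma map_swap_stdMeasure : stdMeasure.map Prod.swap = stdMeasure := by
  have h : MeasurePreserving (Prod.swap : ℝ × ℝ → ℝ × ℝ) volume volume :=
    Measure.measurePreserving_swap
  have := (h.restrict_preimage measurableSet_stdTriangle).map_eq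
  rwa [show Prod.swap ⁻¹' stdTriangle = stdTriangle by
    ext p
    simp only [stdTriangle, mem_preimage, mem_ofPred_eq, Prod.fst_swap, Prod.snd_swap]
    constructor <;> rintro ⟨h1, h2, h3⟩ <;> exact ⟨h2, h1, by linarith⟩] at this

/-- Symmetrizing an isosceles triangle with respect to one of its legs. -/
lemma chainTotal_isosceles_le (hκ : Antitone κ) {E H : ℝ} (hE : 0 < E) (hH : 0 < H) (n : ℕ) :
    chainTotal (formKernel κ E (1 / 2) H) stdMeasure n
      ≤ chainTotal (formKernel κ (E / 4 + H) (1 / 2) (E * H / (E / 4 + H))) stdMeasure n := by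
  have hG : 0 < E / 4 + H := by positivity
  -- With the coordinates exchanged, completing the square gives base parameter `E/4 + H` (the
  -- squared leg) and shear `E / (2(E/4 + H))`, which is then symmetrized away.
  refine le_trans ?_ (chainTotal_le_symmetrized hκ hG.le (E / (2 * (E / 4 + H))) n)
  have h := chainTotal_le (κ := formKernel κ E (1 / 2) H) (μ := stdMeasure) (c := 1)
    (measurable_formKernel hκ (E / 4 + H) (E / (2 * (E / 4 + H))) (E * H / (E / 4 + H)))
    measurable_swap (fun p q => (?_ : _ ≤ _))
    (by rw [map_swap_stdMeasure, one_smul]) n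
  · rwa [one_pow, one_mul] at h
  · refine le_of_eq ?_
    unfold formKernel quadForm
    congr 1
    simp only [Prod.fst_sub, Prod.snd_sub, Prod.fst_swap, Prod.snd_swap]
    field_simp
    ring

/-- The origin is a vertex, so a contraction maps the triangle into itself; the density of the image
is `m⁻²`. -/
lemma map_smul_stdMeasure_le {m : ℝ} (h0 : 0 < m) (h1 : m ≤ 1) :
    stdMeasure.map (fun p => m • p) ≤ ENNReal.ofReal (m ^ 2)⁻¹ • stdMeasure := by
  have hsub : stdTriangle ⊆ (fun p : ℝ × ℝ => m • p) ⁻¹' stdTriangle := by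
    rintro p ⟨hp1, hp2, hp3⟩
    refine ⟨by simpa using mul_pos h0 hp1, by simpa using mul_pos h0 hp2, ?_⟩
    simp only [Prod.smul_fst, Prod.smul_snd, smul_eq_mul]
    nlinarith
  calc stdMeasure.map (fun p => m • p)
      ≤ (volume.restrict ((fun p : ℝ × ℝ => m • p) ⁻¹' stdTriangle)).map (fun p => m • p) :=
        Measure.map_mono (Measure.restrict_mono hsub le_rfl) (measurable_const_smul m)
    _ = (volume.map (fun p : ℝ × ℝ => m • p)).restrict stdTriangle :=
        (Measure.restrict_map (measurable_const_smul m) measurableSet_stdTriangle).symm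
    _ = ENNReal.ofReal (m ^ 2)⁻¹ • stdMeasure := by
        rw [Measure.map_addHaar_smul _ h0.ne', Measure.restrict_smul, stdMeasure]
        simp [abs_of_pos h0]
    _ ≤ _ := le_rfl

/-- Since `κ` is antitone, the form hypothesis says that dilating by `m` and passing to the second
form enlarges the kernel; each of the `n + 1` integrations costs `m⁻²`. This stands in for
continuity of the chain integrals in the shape. -/
lemma chainTotal_le_of_form_le (hκ : Antitone κ) {E s H E' s' H' m : ℝ} (h0 : 0 < m) (h1 : m ≤ 1)
    (hle : ∀ p, m ^ 2 * quadForm E' s' H' p ≤ quadForm E s H p) (n : ℕ) :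
    chainTotal (formKernel κ E s H) stdMeasure n
      ≤ ENNReal.ofReal (m ^ 2)⁻¹ ^ (n + 1)
        * chainTotal (formKernel κ E' s' H') stdMeasure n := by
  refine chainTotal_le (measurable_formKernel hκ _ _ _) (measurable_const_smul m)
    (fun p q => hκ ?_) (map_smul_stdMeasure_le h0 h1) n
  refine le_trans (le_of_eq ?_) (hle (p - q))
  simp only [quadForm, ← smul_sub, Prod.smul_fst, Prod.smul_snd, smul_eq_mul]
  ring

/-- The base parameter of the isosceles triangle obtained from one with base parameter `E` and
area parameter `D2`. -/
noncomputable def nextBase (D2 E : ℝ) : ℝ := E / 4 + D2 / E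

lemma chainTotal_le_iterate (hκ : Antitone κ) {D2 E : ℝ} (hD : 0 < D2) (hE : 0 < E) (n k : ℕ) :
    0 < (nextBase D2)^[k] E ∧ chainTotal (formKernel κ E (1 / 2) (D2 / E)) stdMeasure n
      ≤ chainTotal (formKernel κ ((nextBase D2)^[k] E) (1 / 2) (D2 / (nextBase D2)^[k] E))
          stdMeasure n := by
  induction k with
  | zero => exact ⟨hE, le_rfl⟩
  | succ k ih =>
    rw [Function.iterate_succ_apply']
    set F := (nextBase D2)^[k] E
    refine ⟨by have := ih.1; unfold nextBase; positivity, ih.2.trans ?_⟩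
    have h := chainTotal_isosceles_le hκ ih.1 (div_pos hD ih.1) n
    rwa [mul_div_cancel₀ _ ih.1.ne'] at h

/-- By AM–GM one step already lands above `(√3/2) E₀`, hence above `(4/5) E₀`. There the factor `(x
- 3E₀)/(4x)` has modulus at most `3/4`, which only requires `x ≥ (3/4) E₀`, so the map contracts
towards `E₀`. -/
lemma tendsto_iterate_nextBase {E₀ E : ℝ} (hE₀ : 0 < E₀) (hE : 0 < E) :
    Filter.Tendsto (fun k => (nextBase (3 / 4 * E₀ ^ 2))^[k] E) Filter.atTop (nhds E₀) := by
  set g := nextBase (3 / 4 * E₀ ^ 2) with hg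
  have hpos : ∀ x, 0 < x → 0 < g x := fun x hx => by simp only [hg, nextBase]; positivity
  have hlow : ∀ x, 0 < x → 4 / 5 * E₀ ≤ g x := fun x hx => by
    simp only [hg, nextBase]
    rw [div_add_div _ _ (by norm_num) hx.ne', le_div_iff₀ (by positivity)]
    nlinarith [sq_nonneg (x - 8 / 5 * E₀), mul_pos hE₀ hE₀]
  have hcontr : ∀ x, 4 / 5 * E₀ ≤ x → |g x - E₀| ≤ 3 / 4 * |x - E₀| := fun x hx => by
    have hx0 : 0 < x := by linarith
    have h1 : g x - E₀ = (x - 3 * E₀) / (4 * x) * (x - E₀) := by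
      simp only [hg, nextBase]
      field_simp
      ring
    rw [h1, abs_mul]
    gcongr
    rw [abs_div, abs_of_pos (by positivity : 0 < 4 * x), div_le_iff₀ (by positivity), abs_le]
    constructor <;> linarith
  have hbound : ∀ k, 4 / 5 * E₀ ≤ g^[k + 1] E ∧
      |g^[k + 1] E - E₀| ≤ (3 / 4) ^ k * |g E - E₀| := by
    intro k
    induction k with
    | zero => exact ⟨hlow E hE, by simp⟩
    | succ k ih =>
      rw [Function.iterate_succ_apply']
      refine ⟨hlow _ (by linarith), (hcontr _ ih.1).trans ?_⟩
      rw [pow_succ', mul_assoc]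
      exact mul_le_mul_of_nonneg_left ih.2 (by norm_num)
  rw [← Filter.tendsto_add_atTop_iff_nat 1, tendsto_iff_dist_tendsto_zero]
  refine squeeze_zero (fun _ => dist_nonneg) (fun k => (hbound k).2) ?_
  have := (tendsto_pow_atTop_nhds_zero_of_lt_one (r := (3 / 4 : ℝ)) (by norm_num)
    (by norm_num)).mul_const |g E - E₀|
  rwa [zero_mul] at this

/-- Among all triangles of a given area the chain integrals are largest for the equilateral
triangle. -/
theorem chainTotal_le_equilateral (hκ : Antitone κ) {E s H E₀ : ℝ} (hE : 0 < E)
    (hE₀ : 0 < E₀) (hD : E * H = 3 / 4 * E₀ ^ 2) (n : ℕ) :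
    chainTotal (formKernel κ E s H) stdMeasure n
      ≤ chainTotal (formKernel κ E₀ (1 / 2) (3 / 4 * E₀)) stdMeasure n := by
  have hH : H = 3 / 4 * E₀ ^ 2 / E := by rw [← hD, mul_div_cancel_left₀ _ hE.ne']
  subst hH
  refine (chainTotal_le_symmetrized hκ hE.le s n).trans ?_
  have hit := chainTotal_le_iterate hκ (D2 := 3 / 4 * E₀ ^ 2) (by positivity) hE n
  have hlim := tendsto_iterate_nextBase hE₀ hE
  set e : ℕ → ℝ := fun k => (nextBase (3 / 4 * E₀ ^ 2))^[k] E with he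
  -- The largest squared ratio for which both coefficients of the equilateral form, once multiplied
  -- by it, stay below those of the current form; it is at most `1` and tends to `1`.
  set m2 : ℝ → ℝ := fun x => min (x / E₀) (E₀ / x) with hm2
  have hstep : ∀ k, chainTotal (formKernel κ E (1 / 2) (3 / 4 * E₀ ^ 2 / E)) stdMeasure n
      ≤ ENNReal.ofReal (m2 (e k))⁻¹ ^ (n + 1)
        * chainTotal (formKernel κ E₀ (1 / 2) (3 / 4 * E₀)) stdMeasure n := by
    intro k
    refine (hit k).2.trans ?_
    have hk : 0 < e k := (hit k).1
    have hm0 : 0 < m2 (e k) := lt_min (by positivity) (by positivity)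
    have hm1 : m2 (e k) ≤ 1 := by
      rcases le_total (e k) E₀ with h | h
      · exact (min_le_left _ _).trans ((div_le_one hE₀).2 h)
      · exact (min_le_right _ _).trans ((div_le_one hk).2 h)
    have := chainTotal_le_of_form_le hκ (m := √(m2 (e k))) (Real.sqrt_pos.2 hm0)
      (Real.sqrt_le_one.2 hm1) (E := e k) (s := 1 / 2) (H := 3 / 4 * E₀ ^ 2 / e k)
      (E' := E₀) (s' := 1 / 2) (H' := 3 / 4 * E₀) ?_ n
    · rwa [Real.sq_sqrt hm0.le] at this
    · intro p
      rw [Real.sq_sqrt hm0.le]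
      simp only [quadForm, mul_add]
      rw [← mul_assoc, ← mul_assoc]
      gcongr
      · calc m2 (e k) * E₀ ≤ e k / E₀ * E₀ := by gcongr; exact min_le_left _ _
          _ = e k := div_mul_cancel₀ _ hE₀.ne'
      · calc m2 (e k) * (3 / 4 * E₀) ≤ E₀ / e k * (3 / 4 * E₀) := by
              gcongr
              exact min_le_right _ _
          _ = 3 / 4 * E₀ ^ 2 / e k := by ring
  have hm2lim : Filter.Tendsto (fun k => ENNReal.ofReal (m2 (e k))⁻¹) Filter.atTop (nhds 1) := by
    have h1 : Filter.Tendsto (fun k => (m2 (e k))⁻¹) Filter.atTop (nhds 1) := by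
      have := ((hlim.div_const E₀).min (tendsto_const_nhds.div hlim hE₀.ne' (a := E₀))).inv₀ (by
        simp [div_self hE₀.ne'])
      simpa [div_self hE₀.ne'] using this
    simpa using ENNReal.tendsto_ofReal h1
  have hpow := ENNReal.Tendsto.mul_const
    (b := chainTotal (formKernel κ E₀ (1 / 2) (3 / 4 * E₀)) stdMeasure n)
    (ENNReal.Tendsto.pow (n := n + 1) hm2lim) (Or.inl (by simp))
  rw [one_pow, one_mul] at hpow
  exact ge_of_tendsto' hpow hstep

end StandardTriangle

/-! ### Norms and iterates of symmetric operators -/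

section HilbertSpace

variable {𝕜 H : Type*} [RCLike 𝕜] [NormedAddCommGroup H] [InnerProductSpace 𝕜 H]

open scoped InnerProductSpace

/-- The spectral radius of a self-adjoint operator is its norm. It is positive here, hence attained
in the spectrum, and compactness makes nonzero spectral values eigenvalues. -/
lemma exists_hasEigenvalue_norm_eq [CompleteSpace H] {T : H →L[𝕜] H} (hc : IsCompactOperator T)
    (hs : (T : H →ₗ[𝕜] H).IsSymmetric) (h0 : T ≠ 0) :
    ∃ η : 𝕜, ‖η‖ = ‖T‖ ∧ Module.End.HasEigenvalue (T : H →ₗ[𝕜] H) η := by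
  have hr := T.spectralRadius_eq_nnnorm hs.isSelfAdjoint
  have hpos : (‖T‖₊ : ℝ≥0∞) ≠ 0 := by simpa using h0
  have hne : (spectrum 𝕜 T).Nonempty := by
    by_contra h
    rw [not_nonempty_iff_eq_empty] at h
    exact hpos (hr ▸ by simp [spectralRadius, h])
  obtain ⟨η, hη, hη'⟩ := spectrum.exists_nnnorm_eq_spectralRadius_of_nonempty hne
  rw [hr, ENNReal.coe_inj] at hη'
  refine ⟨η, congrArg NNReal.toReal hη', (hc.hasEigenvalue_iff_mem_spectrum ?_).2 hη⟩
  rintro rfl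
  exact hpos (by simp [← hη'])

/-- A vector at which the quadratic form attains the operator norm is an eigenvector. -/
lemma apply_eq_norm_smul_of_le_re_inner {T : H →L[𝕜] H} {w : H}
    (h : ‖T‖ * ‖w‖ ^ 2 ≤ RCLike.re ⟪w, T w⟫_𝕜) : T w = (‖T‖ : 𝕜) • w := by
  rw [← sub_eq_zero, ← norm_eq_zero, ← sq_eq_zero_iff]
  refine le_antisymm ?_ (sq_nonneg _)
  rw [norm_sub_sq (𝕜 := 𝕜), inner_smul_right, norm_smul, RCLike.norm_ofReal, abs_norm,
    RCLike.re_ofReal_mul, inner_re_symm]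
  have h1 : ‖T w‖ ^ 2 ≤ (‖T‖ * ‖w‖) ^ 2 := by
    gcongr
    exact T.le_opNorm w
  nlinarith [mul_le_mul_of_nonneg_left h (norm_nonneg T)]

lemma inner_iterate_eigenvector {T : H →L[𝕜] H} (hs : (T : H →ₗ[𝕜] H).IsSymmetric) {l : ℝ}
    {u : H} (hu : T u = (l : 𝕜) • u) (v : H) (n : ℕ) :
    ⟪u, (T ^ n) v⟫_𝕜 = (l : 𝕜) ^ n * ⟪u, v⟫_𝕜 := by
  induction n with
  | zero => simp
  | succ n ih =>
    have : ⟪T u, (T ^ n) v⟫_𝕜 = ⟪u, T ((T ^ n) v)⟫_𝕜 := hs u _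
    rw [pow_succ', mul_apply_eq_comp, ← this, hu, inner_smul_left, ih,
      RCLike.conj_ofReal]
    ring

lemma inner_iterate_add {T : H →L[𝕜] H} (hs : (T : H →ₗ[𝕜] H).IsSymmetric) (v w : H) (m n : ℕ) :
    ⟪v, (T ^ (m + n)) w⟫_𝕜 = ⟪(T ^ m) v, (T ^ n) w⟫_𝕜 := by
  induction m generalizing v with
  | zero => simp
  | succ m ih =>
    have : ⟪T v, (T ^ (m + n)) w⟫_𝕜 = ⟪v, T ((T ^ (m + n)) w)⟫_𝕜 := hs v _
    rw [show m + 1 + n = m + n + 1 by ring, pow_succ', mul_apply_eq_comp, ← this, ih,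
      ← mul_apply_eq_comp, ← pow_succ]

lemma re_inner_iterate_le (T : H →L[𝕜] H) (v : H) (n : ℕ) :
    RCLike.re ⟪v, (T ^ n) v⟫_𝕜 ≤ ‖T‖ ^ n * ‖v‖ ^ 2 := by
  have h1 : ‖(T ^ n) v‖ ≤ ‖T‖ ^ n * ‖v‖ := by
    induction n with
    | zero => simp
    | succ n ih =>
      rw [pow_succ', mul_apply_eq_comp, pow_succ', mul_assoc]
      exact (T.le_opNorm _).trans (by gcongr)
  calc RCLike.re ⟪v, (T ^ n) v⟫_𝕜 ≤ ‖v‖ * ‖(T ^ n) v‖ := re_inner_le_norm _ _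
    _ ≤ ‖v‖ * (‖T‖ ^ n * ‖v‖) := by gcongr
    _ = _ := by ring

/-- Operator norms are compared through the growth of the iterates, as soon as the vector `v₁`
has a nonzero component along an eigenvector attaining the norm. -/
lemma norm_le_norm_of_iterates_le {H' : Type*} [NormedAddCommGroup H'] [InnerProductSpace 𝕜 H']
    {T : H →L[𝕜] H} {T' : H' →L[𝕜] H'} (hs : (T : H →ₗ[𝕜] H).IsSymmetric) {u v : H} {v' : H'}
    (hu : T u = (‖T‖ : 𝕜) • u) (huv : ⟪u, v⟫_𝕜 ≠ 0)
    (h : ∀ n, RCLike.re ⟪v, (T ^ n) v⟫_𝕜 ≤ RCLike.re ⟪v', (T' ^ n) v'⟫_𝕜) : ‖T‖ ≤ ‖T'‖ := by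
  by_contra! hlt
  have hu0 : 0 < ‖u‖ := norm_pos_iff.2 (by rintro rfl; simp at huv)
  have hpos : 0 < ‖⟪u, v⟫_𝕜‖ := norm_pos_iff.2 huv
  -- Even powers are used because `⟪v, T²ⁿ v⟫ = ‖Tⁿ v‖²`, which bounds the component along `u`,
  -- growing like `‖T‖ⁿ`.
  have key : ∀ n : ℕ, (‖T‖ ^ 2) ^ n * ‖⟪u, v⟫_𝕜‖ ^ 2
      ≤ (‖T'‖ ^ 2) ^ n * (‖v'‖ ^ 2 * ‖u‖ ^ 2) := fun n => by
    have h1 : ‖T‖ ^ n * ‖⟪u, v⟫_𝕜‖ ≤ ‖u‖ * ‖(T ^ n) v‖ := by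
      have := norm_inner_le_norm (𝕜 := 𝕜) u ((T ^ n) v)
      rwa [inner_iterate_eigenvector hs hu, norm_mul, norm_pow, RCLike.norm_ofReal,
        abs_norm] at this
    have h2 : ‖(T ^ n) v‖ ^ 2 ≤ ‖T'‖ ^ (n + n) * ‖v'‖ ^ 2 := by
      rw [← inner_self_eq_norm_sq (𝕜 := 𝕜), ← inner_iterate_add hs]
      exact (h _).trans (re_inner_iterate_le T' v' _)
    calc (‖T‖ ^ 2) ^ n * ‖⟪u, v⟫_𝕜‖ ^ 2 = (‖T‖ ^ n * ‖⟪u, v⟫_𝕜‖) ^ 2 := by ring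
      _ ≤ (‖u‖ * ‖(T ^ n) v‖) ^ 2 := by gcongr
      _ = ‖u‖ ^ 2 * ‖(T ^ n) v‖ ^ 2 := by ring
      _ ≤ ‖u‖ ^ 2 * (‖T'‖ ^ (n + n) * ‖v'‖ ^ 2) := by gcongr
      _ = _ := by ring
  rcases (norm_nonneg T').eq_or_lt with h0 | h0
  · have h1 := key 1
    rw [← h0] at h1 hlt
    have h2 : 0 < (‖T‖ ^ 2) ^ 1 * ‖⟪u, v⟫_𝕜‖ ^ 2 := by positivity
    norm_num at h1 h2
    linarith
  · have hr : 1 < ‖T‖ ^ 2 / ‖T'‖ ^ 2 := by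
      rw [one_lt_div (by positivity)]
      gcongr
    obtain ⟨n, hn⟩ := pow_unbounded_of_one_lt (‖v'‖ ^ 2 * ‖u‖ ^ 2 / ‖⟪u, v⟫_𝕜‖ ^ 2) hr
    rw [div_pow, div_lt_div_iff₀ (by positivity) (by positivity)] at hn
    linarith [key n]

end HilbertSpace

/-! ### Perron–Frobenius theory of the kernel operator -/

section KernelOperator

open scoped InnerProductSpace

variable {𝕜 : Type*} [RCLike 𝕜] {K : ℝ → ℝ} {Ω : Set Plane}

lemma isFiniteMeasure_restrict_of_isBounded (hb : Bornology.IsBounded Ω) :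
    IsFiniteMeasure ((volume : Measure Plane).restrict Ω) :=
  isFiniteMeasure_restrict.2 hb.measure_lt_top.ne

lemma integrable_kernel_mul_mul (hK : IsRadialKernel K) (ho : IsOpen Ω)
    (hb : Bornology.IsBounded Ω) (f g : L2 𝕜 Ω) :
    Integrable (fun p : Plane × Plane => K ‖p.1 - p.2‖ • (g p.2 * starRingEnd 𝕜 (f p.1)))
      ((volume.restrict Ω).prod (volume.restrict Ω)) := by
  have hf := (Lp.memLp f).1
  have hg := (Lp.memLp g).1
  have hmeas : AEStronglyMeasurable
      (fun p : Plane × Plane => K ‖p.1 - p.2‖ • (g p.2 * starRingEnd 𝕜 (f p.1)))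
      ((volume.restrict Ω).prod (volume.restrict Ω)) :=
    (hK.aestronglyMeasurable Ω).smul (hg.comp_snd.mul
      (RCLike.continuous_conj.comp_aestronglyMeasurable hf.comp_fst))
  refine ⟨hmeas, ?_⟩
  have hsq : ∀ h : L2 𝕜 Ω, ∫⁻ y in Ω, ‖h y‖ₑ ^ 2 < ∞ := fun h => by
    rw [← eLpNorm_two_sq]
    exact ENNReal.pow_lt_top (Lp.memLp h).2
  rw [HasFiniteIntegral, lintegral_prod _ hmeas.enorm]
  have hmul : ∀ a b : ℝ≥0∞, a * b ≤ a ^ 2 + b ^ 2 := fun a b => by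
    rcases le_total a b with h | h
    · calc a * b ≤ b * b := by gcongr
        _ = b ^ 2 := (sq b).symm
        _ ≤ _ := le_add_self
    · calc a * b ≤ a * a := by gcongr
        _ = a ^ 2 := (sq a).symm
        _ ≤ _ := le_self_add
  calc ∫⁻ x in Ω, ∫⁻ y in Ω, ‖K ‖x - y‖ • (g y * starRingEnd 𝕜 (f x))‖ₑ
      = ∫⁻ x in Ω, ‖f x‖ₑ * ∫⁻ y in Ω, ‖K ‖x - y‖‖ₑ * ‖g y‖ₑ := by
        refine lintegral_congr fun x => ?_
        rw [← lintegral_const_mul' _ _ enorm_ne_top]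
        refine lintegral_congr fun y => ?_
        rw [enorm_smul, enorm_mul, RCLike.enorm_conj]
        ring
    _ ≤ ∫⁻ x in Ω, (‖f x‖ₑ ^ 2 + (∫⁻ y in Ω, ‖K ‖x - y‖‖ₑ * ‖g y‖ₑ) ^ 2) :=
        lintegral_mono fun x => hmul _ _
    _ = (∫⁻ x in Ω, ‖f x‖ₑ ^ 2) + ∫⁻ x in Ω, (∫⁻ y in Ω, ‖K ‖x - y‖‖ₑ * ‖g y‖ₑ) ^ 2 :=
        lintegral_add_left' (hf.enorm.pow_const 2) _
    _ < ∞ := ENNReal.add_lt_top.2 ⟨hsq f, (lintegral_kernel_mul_sq_le hK ho hb hg).trans_lt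
        (ENNReal.mul_lt_top (ENNReal.pow_lt_top (hK.schurBound_ne_top Ω).lt_top) (hsq g))⟩

lemma inner_kernelOp_eq (hK : IsRadialKernel K) (ho : IsOpen Ω)
    (hb : Bornology.IsBounded Ω) (f g : L2 𝕜 Ω) :
    ⟪f, kernelOp 𝕜 hK ho hb g⟫_𝕜
      = ∫ p : Plane × Plane, K ‖p.1 - p.2‖ • (g p.2 * starRingEnd 𝕜 (f p.1))
          ∂((volume.restrict Ω).prod (volume.restrict Ω)) := by
  rw [integral_prod _ (integrable_kernel_mul_mul hK ho hb f g), L2.inner_def]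
  refine integral_congr_ae ?_
  filter_upwards [kernelOp_ae_eq 𝕜 hK ho hb g] with x hx
  rw [hx, RCLike.inner_apply, ← integral_mul_const]
  simp_rw [smul_mul_assoc]

lemma isSymmetric_kernelOp (hK : IsRadialKernel K) (ho : IsOpen Ω)
    (hb : Bornology.IsBounded Ω) :
    (kernelOp 𝕜 hK ho hb : L2 𝕜 Ω →ₗ[𝕜] L2 𝕜 Ω).IsSymmetric := by
  intro f g
  change ⟪kernelOp 𝕜 hK ho hb f, g⟫_𝕜 = ⟪f, kernelOp 𝕜 hK ho hb g⟫_𝕜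
  rw [← inner_conj_symm, inner_kernelOp_eq, inner_kernelOp_eq, ← integral_conj,
    ← integral_prod_swap]
  refine integral_congr_ae (Filter.Eventually.of_forall fun p => ?_)
  simp only [Prod.fst_swap, Prod.snd_swap, RCLike.real_smul_eq_coe_mul, map_mul,
    RCLike.conj_conj, RCLike.conj_ofReal]
  rw [norm_sub_rev]
  ring

/-- The absolute value of an element of `L²(Ω)`, as an element of `L²(Ω)`. -/
noncomputable def absL2 (f : L2 𝕜 Ω) : L2 𝕜 Ω :=
  ((Lp.memLp f).norm.ofReal (K := 𝕜)).toLp _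

lemma absL2_ae_eq (f : L2 𝕜 Ω) :
    ∀ᵐ x ∂((volume : Measure Plane).restrict Ω), absL2 f x = ((‖f x‖ : ℝ) : 𝕜) :=
  ((Lp.memLp f).norm.ofReal (K := 𝕜)).coeFn_toLp

lemma norm_absL2 (f : L2 𝕜 Ω) : ‖absL2 f‖ = ‖f‖ := by
  rw [Lp.norm_def, Lp.norm_def]
  congr 1
  refine eLpNorm_congr_norm_ae ?_
  filter_upwards [absL2_ae_eq f] with x hx
  simp [hx]

lemma exists_pos_le_kernel (hK : IsRadialKernel K) (ho : IsOpen Ω)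
    (hb : Bornology.IsBounded Ω) :
    ∃ ε : ℝ, 0 < ε ∧ ∀ᵐ p : Plane × Plane ∂((volume.restrict Ω).prod (volume.restrict Ω)),
      ε ≤ K ‖p.1 - p.2‖ := by
  -- The `+ 1` keeps the argument positive even when the diameter is `0`; the diagonal, where `K` is
  -- unconstrained, is null.
  refine ⟨K (Metric.diam Ω + 1), hK.pos _ (by positivity), ?_⟩
  have hne : ∀ᵐ p : Plane × Plane ∂(volume.prod volume), p.1 - p.2 ≠ 0 :=
    (quasiMeasurePreserving_sub (volume : Measure Plane) volume).ae
      (Measure.ae_ne volume 0)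
  rw [Measure.prod_restrict]
  filter_upwards [ae_restrict_of_ae hne,
    ae_restrict_mem (ho.measurableSet.prod ho.measurableSet)] with p hp hpΩ
  refine hK.anti _ _ (norm_pos_iff.2 hp) ?_
  rw [← dist_eq_norm]
  exact (Metric.dist_le_diam_of_mem hb hpΩ.1 hpΩ.2).trans (by linarith)

/-- A quantitative form of the positivity of the kernel. -/
lemma exists_pos_norm_inner_sub_le (hK : IsRadialKernel K) (ho : IsOpen Ω)
    (hb : Bornology.IsBounded Ω) :
    ∃ ε : ℝ, 0 < ε ∧ ∀ f : L2 𝕜 Ω,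
      ‖⟪f, kernelOp 𝕜 hK ho hb f⟫_𝕜 - ((ε * ‖∫ x in Ω, f x‖ ^ 2 : ℝ) : 𝕜)‖
          + ε * (∫ x in Ω, ‖f x‖) ^ 2
        ≤ RCLike.re ⟪absL2 f, kernelOp 𝕜 hK ho hb (absL2 f)⟫_𝕜 := by
  obtain ⟨ε, hε, hεK⟩ := exists_pos_le_kernel hK ho hb
  refine ⟨ε, hε, fun f => ?_⟩
  have := isFiniteMeasure_restrict_of_isBounded hb
  set μ : Measure Plane := volume.restrict Ω with hμ
  have hfi : Integrable f μ := (Lp.memLp f).integrable one_le_two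
  have hconj : Integrable (fun x => starRingEnd 𝕜 (f x)) μ :=
    (RCLike.conjLIE (K := 𝕜)).integrable_comp_iff.2 hfi
  have hI := integrable_kernel_mul_mul hK ho hb f f
  have hJ : Integrable (fun p : Plane × Plane => ε • (f p.2 * starRingEnd 𝕜 (f p.1)))
      (μ.prod μ) := by
    refine Integrable.smul ε ?_
    simpa only [mul_comm] using hconj.mul_prod hfi
  have hJ' : Integrable (fun p : Plane × Plane => ε * (‖f p.1‖ * ‖f p.2‖)) (μ.prod μ) :=
    (hfi.norm.mul_prod hfi.norm).const_mul ε
  have hIn : Integrable (fun p : Plane × Plane => K ‖p.1 - p.2‖ * (‖f p.1‖ * ‖f p.2‖))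
      (μ.prod μ) := by
    refine hI.norm.congr ?_
    filter_upwards [hεK] with p hp
    rw [norm_smul, norm_mul, RCLike.norm_conj, Real.norm_of_nonneg (hε.le.trans hp)]
    ring
  have hmean : ∫ p, ε • (f p.2 * starRingEnd 𝕜 (f p.1)) ∂(μ.prod μ)
      = ((ε * ‖∫ x, f x ∂μ‖ ^ 2 : ℝ) : 𝕜) := by
    rw [integral_smul]
    have := integral_prod_mul (μ := μ) (ν := μ) (fun x => starRingEnd 𝕜 (f x)) (fun y => f y)
    simp only [mul_comm (f _), this, integral_conj, RCLike.conj_mul]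
    rw [RCLike.real_smul_eq_coe_mul]
    push_cast
    rfl
  have hmean' : ∫ p, ε * (‖f p.1‖ * ‖f p.2‖) ∂(μ.prod μ) = ε * (∫ x, ‖f x‖ ∂μ) ^ 2 := by
    rw [integral_const_mul, integral_prod_mul (fun x => ‖f x‖) (fun y => ‖f y‖), sq]
  have habs : RCLike.re ⟪absL2 f, kernelOp 𝕜 hK ho hb (absL2 f)⟫_𝕜
      = ∫ p : Plane × Plane, K ‖p.1 - p.2‖ * (‖f p.1‖ * ‖f p.2‖) ∂(μ.prod μ) := by
    have : ⟪absL2 f, kernelOp 𝕜 hK ho hb (absL2 f)⟫_𝕜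
        = ∫ p : Plane × Plane, ((K ‖p.1 - p.2‖ * (‖f p.1‖ * ‖f p.2‖) : ℝ) : 𝕜) ∂(μ.prod μ) := by
      rw [inner_kernelOp_eq]
      refine integral_congr_ae ?_
      filter_upwards [Measure.quasiMeasurePreserving_fst.ae (absL2_ae_eq f),
        Measure.quasiMeasurePreserving_snd.ae (absL2_ae_eq f)] with p hp1 hp2
      rw [hp1, hp2, RCLike.real_smul_eq_coe_mul, RCLike.conj_ofReal]
      push_cast
      ring
    rw [this, integral_ofReal, RCLike.ofReal_re]
  -- The claim is the triangle inequality for the integral against `K - ε`, which is still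
  -- nonnegative almost everywhere.
  rw [habs, ← hmean, ← hmean', inner_kernelOp_eq, ← integral_sub hI hJ, ← le_sub_iff_add_le,
    ← integral_sub hIn hJ']
  refine norm_integral_le_of_norm_le (hIn.sub hJ') ?_
  filter_upwards [hεK] with p hp
  rw [← sub_smul, norm_smul, norm_mul, RCLike.norm_conj, Real.norm_of_nonneg (sub_nonneg.2 hp)]
  exact le_of_eq (by ring)

/-- The constant function `1` in `L²(Ω)`. -/
noncomputable def oneL2 (𝕜 : Type*) [RCLike 𝕜] (hb : Bornology.IsBounded Ω) : L2 𝕜 Ω :=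
  haveI := isFiniteMeasure_restrict_of_isBounded hb
  (memLp_const (1 : 𝕜)).toLp _

lemma oneL2_ae_eq (hb : Bornology.IsBounded Ω) :
    ∀ᵐ x ∂((volume : Measure Plane).restrict Ω), oneL2 𝕜 hb x = 1 :=
  haveI := isFiniteMeasure_restrict_of_isBounded hb
  (memLp_const (1 : 𝕜)).coeFn_toLp

lemma integral_norm_pos (hb : Bornology.IsBounded Ω) {f : L2 𝕜 Ω} (hf : f ≠ 0) :
    0 < ∫ x in Ω, ‖f x‖ := by
  have := isFiniteMeasure_restrict_of_isBounded hb
  have hfi : Integrable f (volume.restrict Ω) := (Lp.memLp f).integrable one_le_two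
  refine (integral_nonneg fun x => norm_nonneg _).lt_of_ne fun h => hf ?_
  have h0 := (integral_eq_zero_iff_of_nonneg (fun x => norm_nonneg (f x)) hfi.norm).1 h.symm
  refine (Lp.eq_zero_iff_ae_eq_zero).2 ?_
  filter_upwards [h0] with x hx
  simpa using hx

lemma inner_absL2_oneL2 (hb : Bornology.IsBounded Ω) (f : L2 𝕜 Ω) :
    ⟪absL2 f, oneL2 𝕜 hb⟫_𝕜 = ((∫ x in Ω, ‖f x‖ : ℝ) : 𝕜) := by
  rw [L2.inner_def, ← integral_ofReal]
  refine integral_congr_ae ?_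
  filter_upwards [absL2_ae_eq f, oneL2_ae_eq (𝕜 := 𝕜) hb] with x hx h1
  simp [hx, h1]

lemma kernelOp_ne_zero (𝕜 : Type*) [RCLike 𝕜] (hK : IsRadialKernel K) (ho : IsOpen Ω)
    (hb : Bornology.IsBounded Ω) (hne : Ω.Nonempty) : kernelOp 𝕜 hK ho hb ≠ 0 := by
  intro h
  obtain ⟨ε, hε, hle⟩ := exists_pos_norm_inner_sub_le (𝕜 := 𝕜) hK ho hb
  have h1 : oneL2 𝕜 hb ≠ 0 := by
    intro h0
    have : ∀ᵐ x ∂((volume : Measure Plane).restrict Ω), False := by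
      filter_upwards [oneL2_ae_eq (𝕜 := 𝕜) hb,
        (Lp.eq_zero_iff_ae_eq_zero).1 h0] with x hx hx0
      exact one_ne_zero (hx.symm.trans hx0)
    rw [Filter.eventually_false_iff_eq_bot, ae_eq_bot, Measure.restrict_eq_zero] at this
    exact (ho.measure_pos volume hne).ne' this
  have h2 := hle (oneL2 𝕜 hb)
  have h3 := integral_norm_pos hb h1
  simp only [h, zero_apply, inner_zero_right, map_zero] at h2
  have h4 : 0 < ε * (∫ x in Ω, ‖oneL2 𝕜 hb x‖) ^ 2 := by positivity
  linarith [norm_nonneg ((0 : 𝕜) - ((ε * ‖∫ x in Ω, oneL2 𝕜 hb x‖ ^ 2 : ℝ) : 𝕜))]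

/-- If an eigenvalue has modulus `‖T‖`, then `‖T‖` is an eigenvalue, with eigenvector the absolute
value of the original one. -/
lemma kernelOp_absL2_eq (hK : IsRadialKernel K) (ho : IsOpen Ω)
    (hb : Bornology.IsBounded Ω) {f : L2 𝕜 Ω} {η : 𝕜} (hη : ‖η‖ = ‖kernelOp 𝕜 hK ho hb‖)
    (hf : kernelOp 𝕜 hK ho hb f = η • f) :
    kernelOp 𝕜 hK ho hb (absL2 f) = ((‖kernelOp 𝕜 hK ho hb‖ : ℝ) : 𝕜) • absL2 f := by
  obtain ⟨ε, hε, hle⟩ := exists_pos_norm_inner_sub_le (𝕜 := 𝕜) hK ho hb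
  refine apply_eq_norm_smul_of_le_re_inner (le_trans ?_ (hle f))
  have h1 : ‖∫ x in Ω, f x‖ ≤ ∫ x in Ω, ‖f x‖ := norm_integral_le_integral_norm _
  have h2 : ε * ‖∫ x in Ω, f x‖ ^ 2 ≤ ε * (∫ x in Ω, ‖f x‖) ^ 2 := by gcongr
  -- Removing the mean term costs at most `ε |∫ f|²`, which is covered by `ε (∫ |f|)²`.
  have h3 := norm_le_norm_add_norm_sub' ⟪f, kernelOp 𝕜 hK ho hb f⟫_𝕜
    ((ε * ‖∫ x in Ω, f x‖ ^ 2 : ℝ) : 𝕜)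
  have h4 : ‖⟪f, kernelOp 𝕜 hK ho hb f⟫_𝕜‖ = ‖kernelOp 𝕜 hK ho hb‖ * ‖absL2 f‖ ^ 2 := by
    rw [hf, inner_smul_right, norm_mul, hη, inner_self_eq_norm_sq_to_K, norm_absL2]
    simp
  rw [RCLike.norm_ofReal, abs_of_nonneg (by positivity)] at h3
  linarith

/-- `-‖T‖` is not an eigenvalue. -/
lemma eq_zero_of_kernelOp_eq_neg (hK : IsRadialKernel K) (ho : IsOpen Ω)
    (hb : Bornology.IsBounded Ω) {f : L2 𝕜 Ω}
    (hf : kernelOp 𝕜 hK ho hb f = (-((‖kernelOp 𝕜 hK ho hb‖ : ℝ) : 𝕜)) • f) : f = 0 := by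
  by_contra h0
  obtain ⟨ε, hε, hle⟩ := exists_pos_norm_inner_sub_le (𝕜 := 𝕜) hK ho hb
  have h1 := hle f
  have h2 := integral_norm_pos hb h0
  have h3 : RCLike.re ⟪absL2 f, kernelOp 𝕜 hK ho hb (absL2 f)⟫_𝕜
      ≤ ‖kernelOp 𝕜 hK ho hb‖ * ‖f‖ ^ 2 := by
    have := re_inner_iterate_le (kernelOp 𝕜 hK ho hb) (absL2 f) 1
    rwa [pow_one, pow_one, norm_absL2] at this
  -- For the eigenvalue `-‖T‖` both terms are nonpositive, so their moduli add up and the surplus `ε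
  -- (∫ |f|)² > 0` contradicts the norm bound.
  have h4 : ⟪f, kernelOp 𝕜 hK ho hb f⟫_𝕜 - ((ε * ‖∫ x in Ω, f x‖ ^ 2 : ℝ) : 𝕜)
      = ((-(‖kernelOp 𝕜 hK ho hb‖ * ‖f‖ ^ 2 + ε * ‖∫ x in Ω, f x‖ ^ 2) : ℝ) : 𝕜) := by
    rw [hf, inner_smul_right, inner_self_eq_norm_sq_to_K]
    push_cast
    ring
  rw [h4, RCLike.norm_ofReal, abs_neg, abs_of_nonneg (by positivity)] at h1
  have h5 : 0 < ε * (∫ x in Ω, ‖f x‖) ^ 2 := by positivity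
  have h6 : 0 ≤ ε * ‖∫ x in Ω, f x‖ ^ 2 := by positivity
  linarith

/-- A compact kernel operator has a nonnegative eigenvector for the eigenvalue `‖T‖`, which is not
orthogonal to the constants. -/
lemma exists_principal_eigenvector (hK : IsRadialKernel K) (ho : IsOpen Ω)
    (hb : Bornology.IsBounded Ω) (hne : Ω.Nonempty)
    (hc : IsCompactOperator (kernelOp 𝕜 hK ho hb)) :
    ∃ u : L2 𝕜 Ω, kernelOp 𝕜 hK ho hb u = ((‖kernelOp 𝕜 hK ho hb‖ : ℝ) : 𝕜) • u ∧
      ⟪u, oneL2 𝕜 hb⟫_𝕜 ≠ 0 := by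
  obtain ⟨η, hη, hev⟩ := exists_hasEigenvalue_norm_eq hc (isSymmetric_kernelOp hK ho hb)
    (kernelOp_ne_zero 𝕜 hK ho hb hne)
  obtain ⟨f, hf⟩ := hev.exists_hasEigenvector
  refine ⟨absL2 f, kernelOp_absL2_eq hK ho hb hη hf.apply_eq_smul, ?_⟩
  rw [inner_absL2_oneL2]
  exact_mod_cast (integral_norm_pos hb hf.2).ne'

/-- The first characteristic number of a compact kernel operator is `1 / ‖T‖`. -/
lemma isFirstCharacteristicNumber_kernelOp_iff (hK : IsRadialKernel K) (ho : IsOpen Ω)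
    (hb : Bornology.IsBounded Ω) (hne : Ω.Nonempty)
    (hc : IsCompactOperator (kernelOp 𝕜 hK ho hb)) (ν : 𝕜) :
    IsFirstCharacteristicNumber (kernelOp 𝕜 hK ho hb) ν
      ↔ ν = ((‖kernelOp 𝕜 hK ho hb‖⁻¹ : ℝ) : 𝕜) := by
  have hpos : 0 < ‖kernelOp 𝕜 hK ho hb‖ := norm_pos_iff.2 (kernelOp_ne_zero 𝕜 hK ho hb hne)
  have hsymm := isSymmetric_kernelOp (𝕜 := 𝕜) hK ho hb
  have hsmallest : ∀ ν : 𝕜, IsCharacteristicNumber (kernelOp 𝕜 hK ho hb) ν →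
      ‖kernelOp 𝕜 hK ho hb‖⁻¹ ≤ ‖ν‖ := by
    rintro ν ⟨u, hu0, hu⟩
    have h1 : ‖u‖ ≤ ‖ν‖ * (‖kernelOp 𝕜 hK ho hb‖ * ‖u‖) := by
      conv_lhs => rw [hu, norm_smul]
      gcongr
      exact ContinuousLinearMap.le_opNorm _ _
    have h2 : 0 < ‖u‖ := norm_pos_iff.2 hu0
    rw [inv_le_iff_one_le_mul₀ hpos]
    refine le_of_mul_le_mul_right ?_ h2
    linarith
  have hchar : IsCharacteristicNumber (kernelOp 𝕜 hK ho hb)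
      ((‖kernelOp 𝕜 hK ho hb‖⁻¹ : ℝ) : 𝕜) := by
    obtain ⟨u, hu, hu1⟩ := exists_principal_eigenvector hK ho hb hne hc
    refine ⟨u, by rintro rfl; simp at hu1, ?_⟩
    rw [hu, smul_smul, ← RCLike.ofReal_mul, inv_mul_cancel₀ hpos.ne', RCLike.ofReal_one, one_smul]
  have hnorm : ‖((‖kernelOp 𝕜 hK ho hb‖⁻¹ : ℝ) : 𝕜)‖ = ‖kernelOp 𝕜 hK ho hb‖⁻¹ := by
    rw [RCLike.norm_ofReal, abs_of_pos (inv_pos.2 hpos)]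
  constructor
  · rintro ⟨⟨u, hu0, hu⟩, hmin⟩
    have hν : ‖ν‖ = ‖kernelOp 𝕜 hK ho hb‖⁻¹ :=
      le_antisymm (hnorm ▸ hmin _ hchar) (hsmallest ν ⟨u, hu0, hu⟩)
    have hν0 : ν ≠ 0 := norm_pos_iff.1 (hν ▸ inv_pos.2 hpos)
    have hTu : kernelOp 𝕜 hK ho hb u = ν⁻¹ • u := by
      conv_rhs => rw [hu]
      rw [smul_smul, inv_mul_cancel₀ hν0, one_smul]
    have hev : Module.End.HasEigenvalue
        (kernelOp 𝕜 hK ho hb : L2 𝕜 Ω →ₗ[𝕜] L2 𝕜 Ω) ν⁻¹ :=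
      Module.End.hasEigenvalue_of_hasEigenvector (x := u)
        ⟨Module.End.mem_eigenspace_iff.2 hTu, hu0⟩
    -- Symmetry makes the eigenvalue real, so it is `±‖T‖`, and the negative sign has been excluded.
    obtain ⟨r, hr⟩ := RCLike.conj_eq_iff_real.1 (hsymm.conj_eigenvalue_eq_self hev)
    have habs : |r| = ‖kernelOp 𝕜 hK ho hb‖ := by
      rw [← RCLike.norm_ofReal (K := 𝕜), ← hr, norm_inv, hν, inv_inv]
    rcases abs_choice r with h | h
    · rw [← inv_inv ν, hr, RCLike.ofReal_inv, ← habs, h]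
    · refine absurd (eq_zero_of_kernelOp_eq_neg hK ho hb (f := u) ?_) hu0
      rw [hTu, hr, ← habs, h, RCLike.ofReal_neg, neg_neg]
  · rintro rfl
    exact ⟨hchar, fun ν hν => hnorm.symm ▸ hsmallest ν hν⟩

end KernelOperator

/-! ### From operator iterates to chain integrals -/

section Profile

open scoped InnerProductSpace

/-- The kernel as an antitone extended nonnegative function of the squared distance. -/
noncomputable def kernelProfile (K : ℝ → ℝ) (q : ℝ) : ℝ≥0∞ :=
  open Classical in if 0 < q then ENNReal.ofReal (K √q) else ∞

variable {𝕜 : Type*} [RCLike 𝕜] {K : ℝ → ℝ} {Ω : Set Plane}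

/-- The value `∞` on `q ≤ 0` extends monotonicity to the whole line; it is met only on the null
diagonal. -/
lemma antitone_kernelProfile (hK : IsRadialKernel K) : Antitone (kernelProfile K) := by
  intro p q hpq
  unfold kernelProfile
  split_ifs with hq hp hp
  · exact ENNReal.ofReal_le_ofReal (hK.anti _ _ (Real.sqrt_pos.2 hp) (Real.sqrt_le_sqrt hpq))
  · exact le_top
  · exact absurd (hp.trans_le hpq) hq
  · exact le_rfl

lemma kernelProfile_norm_sq {x : Plane} (hx : x ≠ 0) :
    kernelProfile K (‖x‖ ^ 2) = ENNReal.ofReal (K ‖x‖) := by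
  have : 0 < ‖x‖ := norm_pos_iff.2 hx
  rw [kernelProfile, if_pos (by positivity), Real.sqrt_sq this.le]

/-- The radial kernel on the plane attached to a profile. -/
noncomputable def radialKernel (κ : ℝ → ℝ≥0∞) (x y : Plane) : ℝ≥0∞ := κ (‖x - y‖ ^ 2)

lemma measurable_radialKernel {κ : ℝ → ℝ≥0∞} (hκ : Antitone κ) :
    Measurable (Function.uncurry (radialKernel κ)) :=
  hκ.measurable.comp (f := fun p : Plane × Plane => ‖p.1 - p.2‖ ^ 2) (by fun_prop)

/-- The iterates of the kernel operator on the constant function `1` are the chain iterates. -/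
lemma kernelOp_pow_oneL2_ae_eq (hK : IsRadialKernel K) (ho : IsOpen Ω)
    (hb : Bornology.IsBounded Ω) (n : ℕ) :
    ∀ᵐ x ∂((volume : Measure Plane).restrict Ω),
      chainIter (radialKernel (kernelProfile K)) (volume.restrict Ω) n x ≠ ∞ ∧
      ((kernelOp 𝕜 hK ho hb ^ n) (oneL2 𝕜 hb)) x
        = ((chainIter (radialKernel (kernelProfile K)) (volume.restrict Ω) n x).toReal : 𝕜) := by
  -- Finiteness is carried along because `toReal` would turn an infinite iterate into `0`.
  induction n with
  | zero =>
    filter_upwards [oneL2_ae_eq (𝕜 := 𝕜) hb] with x hx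
    simp [chainIter, hx]
  | succ n ih =>
    set g := (kernelOp 𝕜 hK ho hb ^ n) (oneL2 𝕜 hb) with hg
    set h := chainIter (radialKernel (kernelProfile K)) (volume.restrict Ω) n with hh
    filter_upwards [kernelOp_ae_eq 𝕜 hK ho hb g,
      ae_integrable_kernel hK ho hb (Lp.memLp g)] with x hx hxi
    have hne : ∀ᵐ y ∂((volume : Measure Plane).restrict Ω), x - y ≠ 0 := by
      filter_upwards [ae_restrict_of_ae (Measure.ae_ne volume x)] with y hy
      exact sub_ne_zero.2 hy.symm
    have hnn : ∀ᵐ y ∂((volume : Measure Plane).restrict Ω), 0 ≤ K ‖x - y‖ * (h y).toReal := by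
      filter_upwards [hne] with y hy
      exact mul_nonneg (hK.pos _ (norm_pos_iff.2 hy)).le ENNReal.toReal_nonneg
    have hcongr : (fun y => K ‖x - y‖ • g y) =ᵐ[(volume : Measure Plane).restrict Ω]
        fun y => ((K ‖x - y‖ * (h y).toReal : ℝ) : 𝕜) := by
      filter_upwards [ih] with y hy
      rw [hy.2, RCLike.real_smul_eq_coe_mul, RCLike.ofReal_mul]
    have hint : Integrable (fun y => K ‖x - y‖ * (h y).toReal)
        ((volume : Measure Plane).restrict Ω) := by
      have := (hxi.congr hcongr).re
      simpa only [RCLike.ofReal_re] using this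
    have hval : ENNReal.ofReal (∫ y in Ω, K ‖x - y‖ * (h y).toReal)
        = chainIter (radialKernel (kernelProfile K)) (volume.restrict Ω) (n + 1) x := by
      rw [ofReal_integral_eq_lintegral_ofReal hint hnn]
      refine lintegral_congr_ae ?_
      filter_upwards [hne, ih] with y hy hyi
      rw [radialKernel, kernelProfile_norm_sq hy,
        ENNReal.ofReal_mul (hK.pos _ (norm_pos_iff.2 hy)).le, ENNReal.ofReal_toReal hyi.1]
    refine ⟨hval ▸ ENNReal.ofReal_ne_top, ?_⟩
    rw [pow_succ', mul_apply_eq_comp, ← hg, hx, integral_congr_ae hcongr,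
      integral_ofReal, ← hval, ENNReal.toReal_ofReal (integral_nonneg_of_ae hnn)]

lemma chainTotal_eq_ofReal_inner (𝕜 : Type*) [RCLike 𝕜] (hK : IsRadialKernel K) (ho : IsOpen Ω)
    (hb : Bornology.IsBounded Ω) (n : ℕ) :
    chainTotal (radialKernel (kernelProfile K)) (volume.restrict Ω) n
      = ENNReal.ofReal
          (RCLike.re ⟪oneL2 𝕜 hb, (kernelOp 𝕜 hK ho hb ^ n) (oneL2 𝕜 hb)⟫_𝕜) := by
  have := isFiniteMeasure_restrict_of_isBounded hb
  set h := chainIter (radialKernel (kernelProfile K)) (volume.restrict Ω) n with hh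
  have hae := kernelOp_pow_oneL2_ae_eq (𝕜 := 𝕜) hK ho hb n
  have hint : Integrable (fun x => (h x).toReal) ((volume : Measure Plane).restrict Ω) := by
    have h1 : Integrable ((kernelOp 𝕜 hK ho hb ^ n) (oneL2 𝕜 hb))
        ((volume : Measure Plane).restrict Ω) := (Lp.memLp _).integrable one_le_two
    refine h1.re.congr ?_
    filter_upwards [hae] with x hx
    rw [hx.2, RCLike.ofReal_re]
  have hin : ⟪oneL2 𝕜 hb, (kernelOp 𝕜 hK ho hb ^ n) (oneL2 𝕜 hb)⟫_𝕜
      = ((∫ x in Ω, (h x).toReal : ℝ) : 𝕜) := by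
    rw [L2.inner_def, ← integral_ofReal]
    refine integral_congr_ae ?_
    filter_upwards [hae, oneL2_ae_eq (𝕜 := 𝕜) hb] with x hx h1
    rw [hx.2, h1]
    simp [hh]
  rw [hin, RCLike.ofReal_re, ofReal_integral_eq_lintegral_ofReal hint
    (Filter.Eventually.of_forall fun x => ENNReal.toReal_nonneg), chainTotal]
  refine lintegral_congr_ae ?_
  filter_upwards [hae] with x hx
  exact (ENNReal.ofReal_toReal hx.1).symm

/-- Comparison of operator norms through the chain integrals. -/
lemma norm_kernelOp_le_of_chainTotal_le (𝕜 : Type*) [RCLike 𝕜] (hK : IsRadialKernel K)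
    {Ω' : Set Plane} (ho : IsOpen Ω) (hb : Bornology.IsBounded Ω) (hne : Ω.Nonempty)
    (hc : IsCompactOperator (kernelOp 𝕜 hK ho hb)) (ho' : IsOpen Ω')
    (hb' : Bornology.IsBounded Ω')
    (h : ∀ n, chainTotal (radialKernel (kernelProfile K)) (volume.restrict Ω) n
      ≤ chainTotal (radialKernel (kernelProfile K)) (volume.restrict Ω') n) :
    ‖kernelOp 𝕜 hK ho hb‖ ≤ ‖kernelOp 𝕜 hK ho' hb'‖ := by
  obtain ⟨u, hu, hu1⟩ := exists_principal_eigenvector hK ho hb hne hc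
  refine norm_le_norm_of_iterates_le (isSymmetric_kernelOp hK ho hb) hu hu1
    (v' := oneL2 𝕜 hb') fun n => ?_
  have h1 := h n
  rw [chainTotal_eq_ofReal_inner 𝕜 hK ho hb, chainTotal_eq_ofReal_inner 𝕜 hK ho' hb'] at h1
  -- `ENNReal.ofReal` reflects the order only when the right-hand side is nonnegative, which follows
  -- from the positivity of the iterates.
  refine (ENNReal.ofReal_le_ofReal_iff ?_).1 h1
  have hnn : ∀ᵐ x ∂((volume : Measure Plane).restrict Ω'),
      0 ≤ RCLike.re ⟪oneL2 𝕜 hb' x, ((kernelOp 𝕜 hK ho' hb' ^ n) (oneL2 𝕜 hb')) x⟫_𝕜 := by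
    filter_upwards [kernelOp_pow_oneL2_ae_eq (𝕜 := 𝕜) hK ho' hb' n,
      oneL2_ae_eq (𝕜 := 𝕜) hb'] with x hx h1
    rw [hx.2, h1]
    simp
  rw [L2.inner_def, ← integral_re (L2.integrable_inner _ _)]
  exact integral_nonneg_of_ae hnn

end Profile

/-! ### Affine coordinates on a triangle -/

section TriangleCoordinates

open scoped InnerProductSpace

lemma measurePreserving_prod_toPlane :
    MeasurePreserving (fun p : ℝ × ℝ => (!₂[p.1, p.2] : Plane)) volume volume :=
  (EuclideanSpace.volume_preserving_symm_measurableEquiv_toLp (Fin 2)).symm.comp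
    (volume_preserving_finTwoArrow ℝ).symm

/-- The linear map of the plane sending the standard basis to `u, v`. -/
noncomputable def planeMap (u v : Plane) : Plane →ₗ[ℝ] Plane where
  toFun x := x 0 • u + x 1 • v
  map_add' x y := by
    simp only [PiLp.add_apply, add_smul]
    abel
  map_smul' c x := by simp [smul_smul]

lemma planeMap_apply (u v x : Plane) : planeMap u v x = x 0 • u + x 1 • v := rfl

lemma det_planeMap (u v : Plane) : LinearMap.det (planeMap u v) = u 0 * v 1 - u 1 * v 0 := by
  rw [← LinearMap.det_toMatrix (EuclideanSpace.basisFun (Fin 2) ℝ).toBasis, Matrix.det_fin_two]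
  simp [LinearMap.toMatrix_apply, planeMap_apply]
  ring

variable (t : Affine.Triangle ℝ Plane)

/-- The two sides of a triangle issuing from its first vertex. -/
noncomputable def side (i : Fin 3) : Plane := t.points i - t.points 0

/-- The affine parametrization of a triangle by the standard triangle. -/
noncomputable def param (p : ℝ × ℝ) : Plane := t.points 0 + (p.1 • side t 1 + p.2 • side t 2)

/-- The vertices of a triangle, as an affine basis of the plane. -/
noncomputable def vertexBasis : AffineBasis (Fin 3) ℝ Plane where
  toFun := t.points
  ind' := t.independent
  tot' := t.independent.affineSpan_eq_top_iff_card_eq_finrank_add_one.2 (by simp)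

lemma vertexBasis_coord_param (i : Fin 3) (p : ℝ × ℝ) :
    (vertexBasis t).coord i (param t p) = ![1 - p.1 - p.2, p.1, p.2] i := by
  have hlin : ∀ j, ((vertexBasis t).coord i).linear (side t j)
      = (if i = j then 1 else 0) - (if i = 0 then 1 else 0) := fun j => by
    rw [side, ← vsub_eq_sub, AffineMap.linearMap_vsub, vsub_eq_sub]
    exact congrArg₂ _ ((vertexBasis t).coord_apply i j) ((vertexBasis t).coord_apply i 0)
  have h0 : (vertexBasis t).coord i (t.points 0) = if i = 0 then 1 else 0 :=
    (vertexBasis t).coord_apply i 0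
  rw [param, add_comm, ← vadd_eq_add, AffineMap.map_vadd, map_add, map_smul, map_smul, hlin, hlin,
    h0]
  fin_cases i <;> simp
  ring

/-- The inverse of the affine parametrization of a triangle. -/
noncomputable def paramInv (x : Plane) : ℝ × ℝ :=
  ((vertexBasis t).coord 1 x, (vertexBasis t).coord 2 x)

lemma paramInv_param (p : ℝ × ℝ) : paramInv t (param t p) = p := by
  simp [paramInv, vertexBasis_coord_param]

lemma det_planeMap_side_ne_zero : LinearMap.det (planeMap (side t 1) (side t 2)) ≠ 0 := by
  intro h
  -- A kernel vector would give two parameters with the same image, against the left inverse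
  -- supplied by barycentric coordinates.
  obtain ⟨x, hx, hx0⟩ := Submodule.exists_mem_ne_zero_of_ne_bot
    (LinearMap.bot_lt_ker_of_det_eq_zero h).ne'
  have h1 : x 0 • side t 1 + x 1 • side t 2 = 0 := hx
  have h2 : param t (x 0, x 1) = param t 0 := by simp [param, h1]
  have h3 := congrArg (paramInv t) h2
  rw [paramInv_param, paramInv_param, Prod.mk_eq_zero] at h3
  refine hx0 (PiLp.ext fun i => ?_)
  fin_cases i
  exacts [h3.1, h3.2]

lemma param_paramInv (x : Plane) : param t (paramInv t x) = x := by
  have hsurj : Function.Surjective (planeMap (side t 1) (side t 2)) :=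
    (LinearEquiv.ofIsUnitDet (f := planeMap (side t 1) (side t 2))
      (v := (EuclideanSpace.basisFun (Fin 2) ℝ).toBasis)
      (v' := (EuclideanSpace.basisFun (Fin 2) ℝ).toBasis)
      (by rw [LinearMap.det_toMatrix]; exact (det_planeMap_side_ne_zero t).isUnit)).surjective
  obtain ⟨y, hy⟩ := hsurj (x - t.points 0)
  have hx : x = param t (y 0, y 1) := by
    have : param t (y 0, y 1) = t.points 0 + planeMap (side t 1) (side t 2) y := rfl
    rw [this, hy, add_sub_cancel]
  rw [hx, paramInv_param]

lemma measurable_param : Measurable (param t) := by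
  unfold param
  fun_prop

lemma measurable_paramInv : Measurable (paramInv t) :=
  ((vertexBasis t).coord 1).continuous_of_finiteDimensional.measurable.prodMk
    ((vertexBasis t).coord 2).continuous_of_finiteDimensional.measurable

lemma triangleDomain_eq_preimage : triangleDomain t = paramInv t ⁻¹' stdTriangle := by
  have h : triangleDomain t = {x | ∀ i, 0 < (vertexBasis t).coord i x} :=
    (vertexBasis t).interior_convexHull
  ext x
  obtain ⟨p, rfl⟩ : ∃ p, param t p = x := ⟨_, param_paramInv t x⟩
  rw [h, mem_preimage, paramInv_param]
  simp only [mem_ofPred_eq, vertexBasis_coord_param, Fin.forall_fin_succ, stdTriangle]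
  simp
  constructor
  · rintro ⟨h1, h2, h3⟩
    exact ⟨h2, h3, by linarith⟩
  · rintro ⟨h1, h2, h3⟩
    exact ⟨by linarith, h1, h2⟩

/-- Twice the area of a triangle. -/
noncomputable def areaFactor : ℝ := |LinearMap.det (planeMap (side t 1) (side t 2))|

lemma areaFactor_pos : 0 < areaFactor t := abs_pos.2 (det_planeMap_side_ne_zero t)

lemma map_param_volume :
    (volume : Measure (ℝ × ℝ)).map (param t) = ENNReal.ofReal (areaFactor t)⁻¹ • volume := by
  have h : param t = (fun x => t.points 0 + x) ∘ planeMap (side t 1) (side t 2) ∘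
      fun p : ℝ × ℝ => (!₂[p.1, p.2] : Plane) := by
    ext p
    simp [param, planeMap_apply]
  have hm : Measurable (planeMap (side t 1) (side t 2)) :=
    (planeMap (side t 1) (side t 2)).continuous_of_finiteDimensional.measurable
  rw [h, ← Measure.map_map (measurable_const_add _)
      (hm.comp measurePreserving_prod_toPlane.measurable),
    ← Measure.map_map hm measurePreserving_prod_toPlane.measurable,
    measurePreserving_prod_toPlane.map_eq,
    Measure.map_linearMap_addHaar_eq_smul_addHaar _ (det_planeMap_side_ne_zero t),
    Measure.map_smul, map_add_left_eq_self, abs_inv]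
  rfl

lemma map_param_stdMeasure :
    stdMeasure.map (param t)
      = ENNReal.ofReal (areaFactor t)⁻¹ • volume.restrict (triangleDomain t) := by
  have hpre : param t ⁻¹' triangleDomain t = stdTriangle := by
    ext p
    rw [triangleDomain_eq_preimage, mem_preimage, mem_preimage, paramInv_param]
  rw [stdMeasure, ← hpre,
    ← Measure.restrict_map (measurable_param t) (isOpen_triangleDomain t).measurableSet,
    map_param_volume, Measure.restrict_smul]

lemma ofReal_areaFactor_mul_inv :
    ENNReal.ofReal (areaFactor t) * ENNReal.ofReal (areaFactor t)⁻¹ = 1 := by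
  rw [← ENNReal.ofReal_mul (areaFactor_pos t).le, mul_inv_cancel₀ (areaFactor_pos t).ne',
    ENNReal.ofReal_one]

lemma volume_restrict_triangleDomain :
    volume.restrict (triangleDomain t)
      = ENNReal.ofReal (areaFactor t) • stdMeasure.map (param t) := by
  rw [map_param_stdMeasure, smul_smul, ofReal_areaFactor_mul_inv, one_smul]

lemma map_paramInv_volume_restrict :
    (volume.restrict (triangleDomain t)).map (paramInv t)
      = ENNReal.ofReal (areaFactor t) • stdMeasure := by
  rw [volume_restrict_triangleDomain, Measure.map_smul,
    Measure.map_map (measurable_paramInv t) (measurable_param t),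
    show paramInv t ∘ param t = id from funext (paramInv_param t), Measure.map_id]

lemma volume_triangleDomain :
    volume (triangleDomain t) = ENNReal.ofReal (areaFactor t) * volume stdTriangle := by
  have h := congrArg (fun μ => μ univ) (volume_restrict_triangleDomain t)
  simpa [Measure.map_apply (measurable_param t) MeasurableSet.univ, stdMeasure] using h

lemma volume_stdTriangle_ne_zero : volume stdTriangle ≠ 0 := by
  have ho : IsOpen stdTriangle :=
    (isOpen_lt continuous_const continuous_fst).inter
      ((isOpen_lt continuous_const continuous_snd).inter
        (isOpen_lt (continuous_fst.add continuous_snd) continuous_const))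
  exact (ho.measure_pos volume ⟨(1 / 3, 1 / 3), by norm_num [stdTriangle]⟩).ne'

lemma volume_stdTriangle_ne_top : volume stdTriangle ≠ ∞ := by
  refine ne_top_of_le_ne_top ?_ (measure_mono (t := Ioo (0 : ℝ) 1 ×ˢ Ioo (0 : ℝ) 1) ?_)
  · rw [Measure.volume_eq_prod, Measure.prod_prod, Real.volume_Ioo]
    exact ENNReal.mul_ne_top ENNReal.ofReal_ne_top ENNReal.ofReal_ne_top
  · rintro p ⟨h1, h2, h3⟩
    exact ⟨⟨h1, by linarith⟩, ⟨h2, by linarith⟩⟩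

lemma nonempty_triangleDomain : (triangleDomain t).Nonempty :=
  ⟨param t (1 / 3, 1 / 3), by
    rw [triangleDomain_eq_preimage, mem_preimage, paramInv_param]
    norm_num [stdTriangle]⟩

lemma areaFactor_eq_of_volume_eq {t t' : Affine.Triangle ℝ Plane}
    (h : volume (triangleDomain t) = volume (triangleDomain t')) :
    areaFactor t = areaFactor t' := by
  rw [volume_triangleDomain, volume_triangleDomain,
    ENNReal.mul_left_inj volume_stdTriangle_ne_zero volume_stdTriangle_ne_top,
    ENNReal.ofReal_eq_ofReal_iff (areaFactor_pos t).le (areaFactor_pos t').le] at h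
  exact h

/-- The squared length of the base of a triangle. -/
noncomputable def baseSq : ℝ := ‖side t 1‖ ^ 2

/-- The position of the foot of the altitude, relative to the base. -/
noncomputable def footPos : ℝ := ⟪side t 1, side t 2⟫_ℝ / baseSq t

/-- The squared altitude of a triangle. -/
noncomputable def altitudeSq : ℝ := areaFactor t ^ 2 / baseSq t

/-- Lagrange's identity: the squared determinant of the two sides is their Gram determinant. -/
lemma areaFactor_sq :
    areaFactor t ^ 2 = ‖side t 1‖ ^ 2 * ‖side t 2‖ ^ 2 - ⟪side t 1, side t 2⟫_ℝ ^ 2 := by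
  rw [areaFactor, sq_abs, det_planeMap, EuclideanSpace.norm_sq_eq, EuclideanSpace.norm_sq_eq,
    PiLp.inner_apply]
  simp only [Fin.sum_univ_two, Real.norm_eq_abs, sq_abs, RCLike.inner_apply, conj_trivial]
  ring

lemma baseSq_pos : 0 < baseSq t := by
  have h := areaFactor_sq t
  have h1 := areaFactor_pos t
  refine (sq_nonneg _).lt_of_ne' fun h0 => ?_
  rw [h0, zero_mul, zero_sub] at h
  nlinarith [sq_nonneg ⟪side t 1, side t 2⟫_ℝ]

/-- Completing the square along the base splits the squared length into its parts parallel and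
orthogonal to the base. -/
lemma norm_param_sub_sq (p q : ℝ × ℝ) :
    ‖param t p - param t q‖ ^ 2 = quadForm (baseSq t) (footPos t) (altitudeSq t) (p - q) := by
  have h : param t p - param t q = (p - q).1 • side t 1 + (p - q).2 • side t 2 := by
    simp only [param, Prod.fst_sub, Prod.snd_sub, sub_smul]
    abel
  have hb := (baseSq_pos t).ne'
  rw [h, norm_add_sq_real, norm_smul, norm_smul, mul_pow, mul_pow, Real.norm_eq_abs,
    Real.norm_eq_abs, sq_abs, sq_abs, real_inner_smul_left, real_inner_smul_right, quadForm,
    footPos, altitudeSq, areaFactor_sq]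
  rw [show ‖side t 1‖ ^ 2 = baseSq t from rfl]
  field_simp
  ring

lemma radialKernel_param (κ : ℝ → ℝ≥0∞) (p q : ℝ × ℝ) :
    radialKernel κ (param t p) (param t q)
      = formKernel κ (baseSq t) (footPos t) (altitudeSq t) p q := by
  rw [radialKernel, norm_param_sub_sq, formKernel]

lemma chainTotal_triangleDomain_le {κ : ℝ → ℝ≥0∞} (hκ : Antitone κ) (n : ℕ) :
    chainTotal (radialKernel κ) (volume.restrict (triangleDomain t)) n
      ≤ ENNReal.ofReal (areaFactor t) ^ (n + 1)
        * chainTotal (formKernel κ (baseSq t) (footPos t) (altitudeSq t)) stdMeasure n := by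
  refine chainTotal_le (measurable_formKernel hκ _ _ _) (measurable_paramInv t)
    (fun x y => le_of_eq ?_) (map_paramInv_volume_restrict t).le n
  rw [← radialKernel_param, param_paramInv, param_paramInv]

/-- The reverse of the preceding bound, obtained by transporting along the inverse map; the two area
factors cancel. -/
lemma le_chainTotal_triangleDomain {κ : ℝ → ℝ≥0∞} (hκ : Antitone κ) (n : ℕ) :
    ENNReal.ofReal (areaFactor t) ^ (n + 1)
        * chainTotal (formKernel κ (baseSq t) (footPos t) (altitudeSq t)) stdMeasure n
      ≤ chainTotal (radialKernel κ) (volume.restrict (triangleDomain t)) n := by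
  calc _ ≤ ENNReal.ofReal (areaFactor t) ^ (n + 1) * (ENNReal.ofReal (areaFactor t)⁻¹ ^ (n + 1)
        * chainTotal (radialKernel κ) (volume.restrict (triangleDomain t)) n) := by
        gcongr
        exact chainTotal_le (measurable_radialKernel hκ) (measurable_param t)
          (fun p q => (radialKernel_param t κ p q).ge) (map_param_stdMeasure t).le n
    _ = _ := by
        rw [← mul_assoc, ← mul_pow, ofReal_areaFactor_mul_inv, one_pow, one_mul]

lemma baseSq_mul_altitudeSq : baseSq t * altitudeSq t = areaFactor t ^ 2 :=
  mul_div_cancel₀ _ (baseSq_pos t).ne'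

variable {t} in
lemma Affine.Simplex.Equilateral.footPos_eq (h : t.Equilateral) : footPos t = 1 / 2 ∧
    altitudeSq t = 3 / 4 * baseSq t := by
  have h1 : ‖side t 1‖ = ‖side t 2‖ := by
    simpa only [side, ← dist_eq_norm] using
      h.dist_eq (i₁ := 1) (i₂ := 0) (i₃ := 2) (i₄ := 0) (by decide) (by decide)
  have h2 : ‖side t 1 - side t 2‖ = ‖side t 1‖ := by
    simpa only [side, sub_sub_sub_cancel_right, ← dist_eq_norm] using
      h.dist_eq (i₁ := 1) (i₂ := 2) (i₃ := 1) (i₄ := 0) (by decide) (by decide)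
  have hb := (baseSq_pos t).ne'
  have h3 : ⟪side t 1, side t 2⟫_ℝ = baseSq t / 2 := by
    have := norm_sub_sq_real (side t 1) (side t 2)
    rw [h2, ← h1] at this
    rw [baseSq]
    linarith
  constructor
  · rw [footPos, h3]
    field_simp
  · rw [altitudeSq, areaFactor_sq, ← h1, h3, ← baseSq]
    field_simp
    ring

end TriangleCoordinates

/-! ### The comparison theorem -/

theorem theorem4p3 {𝕜 : Type*} [RCLike 𝕜] {K : ℝ → ℝ} (hK : IsRadialKernel K)
    (Δ Ω : Affine.Triangle ℝ Plane) (hΔ : Δ.Equilateral)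
    (harea : volume (triangleDomain Ω) = volume (triangleDomain Δ))
    (hcΔ : IsCompactOperator (triangleOp 𝕜 hK Δ))
    (hcΩ : IsCompactOperator (triangleOp 𝕜 hK Ω)) :
    ∃ μΔ μΩ : ℝ,
      (∀ ν : 𝕜, IsFirstCharacteristicNumber (triangleOp 𝕜 hK Δ) ν ↔ ν = (μΔ : 𝕜)) ∧
      (∀ ν : 𝕜, IsFirstCharacteristicNumber (triangleOp 𝕜 hK Ω) ν ↔ ν = (μΩ : 𝕜)) ∧
      0 < μΔ ∧ μΔ ≤ μΩ ∧
      ‖triangleOp 𝕜 hK Δ‖ = μΔ⁻¹ ∧ ‖triangleOp 𝕜 hK Ω‖ = μΩ⁻¹ ∧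
      ‖triangleOp 𝕜 hK Ω‖ ≤ ‖triangleOp 𝕜 hK Δ‖ := by
  have hneΔ := nonempty_triangleDomain Δ
  have hneΩ := nonempty_triangleDomain Ω
  have hκ := antitone_kernelProfile hK
  have hfactor := areaFactor_eq_of_volume_eq harea
  obtain ⟨hfoot, halt⟩ := hΔ.footPos_eq
  have hle : ‖triangleOp 𝕜 hK Ω‖ ≤ ‖triangleOp 𝕜 hK Δ‖ := by
    refine norm_kernelOp_le_of_chainTotal_le 𝕜 hK _ _ hneΩ hcΩ _ _ fun n => ?_
    refine (chainTotal_triangleDomain_le Ω hκ n).trans (le_trans ?_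
      (le_chainTotal_triangleDomain Δ hκ n))
    rw [hfactor, hfoot, halt]
    gcongr
    refine chainTotal_le_equilateral hκ (baseSq_pos Ω) (baseSq_pos Δ) ?_ n
    -- Equal areas give equal products `EH`, and for the equilateral triangle `H = (3/4) E`.
    rw [baseSq_mul_altitudeSq, hfactor, ← baseSq_mul_altitudeSq, halt]
    ring
  have hpos : ∀ t : Affine.Triangle ℝ Plane, 0 < ‖triangleOp 𝕜 hK t‖ := fun t =>
    norm_pos_iff.2 (kernelOp_ne_zero 𝕜 hK _ _ (nonempty_triangleDomain t))
  exact ⟨‖triangleOp 𝕜 hK Δ‖⁻¹, ‖triangleOp 𝕜 hK Ω‖⁻¹,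
    isFirstCharacteristicNumber_kernelOp_iff hK _ _ hneΔ hcΔ,
    isFirstCharacteristicNumber_kernelOp_iff hK _ _ hneΩ hcΩ,
    inv_pos.2 (hpos Δ), inv_anti₀ (hpos Ω) hle, (inv_inv _).symm, (inv_inv _).symm, hle⟩
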